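/- Let $n\ge 2$, $r_0>0$, let $p\in C^\infty((0,\infty))$ satisfy $p'(\rho)>0$ for all $\rho>0$, and let $\rho_+>0$. There exist constants $\epsilon_0,\nu_0,C>0$ and, for each $\alpha\in(0,1)$, a constant $C_\alpha>0$, depending only on $n,r_0,p,\rho_+$ (and $C_\alpha$ also on $\alpha$), such that the following holds for all $u_->0$ and $\rho_->0$ with $|u_-|+|\rho_--\rho_+|\le\epsilon_0$. (All solutions are pairs of functions which are smooth up to the boundary, with positive density.) (I) There is a unique smooth solution $(\rho^E,u^E)$ on $[r_0,\infty)$ of the Euler problem $$(r^{n-1}\rho^Eu^E)_r=0,\qquad \rho^Eu^Eu^E_r+p(\rho^E)_r=0\quad(r>r_0),\qquad \lim_{r\to\infty}(\rho^E,u^E)(r)=(\rho_+,0),\qquad \rho^E(r_0)u^E(r_0)=\rho_-u_-,$$ and it satisfies, for all $r\ge r_0$, $$|\rho^E(r)-\rho_+|\le Cr^{-2(n-1)}|u_-|^2,\qquad C^{-1}r^{-(n-1)}|u_-|\le|u^E(r)|\le Cr^{-(n-1)}|u_-|.$$ (II) There is a unique smooth solution $(\rho^B,u^B)$ on $[0,\infty)$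 of the boundary layer problem $$(\rho^Bu^B)_y=0,\qquad \rho^Bu^Bu^B_y+p(\rho^B)_y=u^B_{yy}\quad(y>0),\qquad \lim_{y\to\infty}(\rho^B,u^B)(y)=(\rho^E(r_0),u^E(r_0)),\qquad (\rho^B,u^B)(0)=(\rho_-,u_-),$$ and, with $\epsilon=\rho_-u_-$, it satisfies, for all $y\ge0$, $$|\rho^B(y)-\rho^E(r_0)|\le Ce^{-\frac{\nu_0}{\epsilon}y}\big(|u_-|^2+|\rho_--\rho_+|\big),\qquad |u^B(y)-u^E(r_0)|\le Ce^{-\frac{\nu_0}{\epsilon}y}\big(|u_-|^2+|\rho_--\rho_+|\big).$$ (III) For every $\mu\in(0,1]$ there is a unique smooth solution $(\rho,u)$ on $[r_0,\infty)$ of the stationary Navier–Stokes problem $$(r^{n-1}\rho u)_r=0,\qquad \rho uu_r+p(\rho)_r=\mu\Big(\frac{(r^{n-1}u)_r}{r^{n-1}}\Big)_r\quad(r>r_0),\qquad \lim_{r\to\infty}(\rho,u)(r)=(\rho_+,0),\qquad (\rho,u)(r_0)=(\rho_-,u_-),$$ and for every $\alpha\in(0,1)$ $$\sup_{r\ge r_0}\Big|\rho(r)-\rho^E(r)-\rho^B\Big(\frac{r-r_0}{\mu}\Big)+\rho^E(r_0)\Big|\le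 C_\alpha\mu^\alpha,\qquad \sup_{r\ge r_0}\Big|u(r)-u^E(r)-u^B\Big(\frac{r-r_0}{\mu}\Big)+u^E(r_0)\Big|\le C_\alpha\mu^\alpha .$$ -/

import Mathlib

open Set Filter Topology
open scoped ContDiff

/-- An admissible barotropic pressure law: smooth for positive densities, with positive
derivative there. (Values of `p` at non-positive densities play no role.) -/
structure IsPressureLaw (p : ℝ → ℝ) : Prop where
  smooth : ContDiffOn ℝ ∞ p (Ioi 0)
  deriv_pos : ∀ ρ : ℝ, 0 < ρ → 0 < deriv p ρ

/-- Smooth pair `(ρ, u)` on the closed half line `[a, ∞)` with positive density. -/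
structure IsSmoothState (a : ℝ) (ρ u : ℝ → ℝ) : Prop where
  smooth_density : ContDiffOn ℝ ∞ ρ (Ici a)
  smooth_velocity : ContDiffOn ℝ ∞ u (Ici a)
  density_pos : ∀ r : ℝ, a ≤ r → 0 < ρ r

/-- Smooth solution on `[r₀, ∞)` of the stationary radially symmetric compressible Navier-Stokes
problem (inflow case) in dimension `n` with viscosity `μ`, far field state `(ρp, up)` and
boundary state `(ρm, um)`:
`(r^(n-1) ρ u)_r = 0` and `ρ u u_r + p(ρ)_r = μ ((r^(n-1) u)_r / r^(n-1))_r` for `r > r₀`. -/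
structure IsNavierStokesSolution (n : ℕ) (r₀ μ : ℝ) (p : ℝ → ℝ) (ρp up ρm um : ℝ)
    (ρ u : ℝ → ℝ) : Prop extends IsSmoothState r₀ ρ u where
  mass : ∀ r : ℝ, r₀ < r → deriv (fun s => s ^ (n - 1) * ρ s * u s) r = 0
  momentum : ∀ r : ℝ, r₀ < r →
    ρ r * u r * deriv u r + deriv (fun s => p (ρ s)) r
      = μ * deriv (fun s => deriv (fun t => t ^ (n - 1) * u t) s / s ^ (n - 1)) r
  density_far : Tendsto ρ atTop (𝓝 ρp)
  velocity_far : Tendsto u atTop (𝓝 up)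
  density_bdry : ρ r₀ = ρm
  velocity_bdry : u r₀ = um

/-- Smooth solution on `[r₀, ∞)` of the stationary radially symmetric compressible Euler problem
with far field state `(ρp, up)` and prescribed mass flux `m` at `r = r₀`. -/
structure IsEulerSolution (n : ℕ) (r₀ : ℝ) (p : ℝ → ℝ) (ρp up m : ℝ)
    (ρ u : ℝ → ℝ) : Prop extends IsSmoothState r₀ ρ u where
  mass : ∀ r : ℝ, r₀ < r → deriv (fun s => s ^ (n - 1) * ρ s * u s) r = 0
  momentum : ∀ r : ℝ, r₀ < r →
    ρ r * u r * deriv u r + deriv (fun s => p (ρ s)) r = 0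
  density_far : Tendsto ρ atTop (𝓝 ρp)
  velocity_far : Tendsto u atTop (𝓝 up)
  flux_bdry : ρ r₀ * u r₀ = m

/-- Smooth solution on `[0, ∞)` of the boundary layer problem
`(ρ u)_y = 0`, `ρ u u_y + p(ρ)_y = u_yy` for `y > 0`, with limit `(ρinf, uinf)` as `y → ∞`
and boundary state `(ρm, um)` at `y = 0`. -/
structure IsBoundaryLayerSolution (p : ℝ → ℝ) (ρinf uinf ρm um : ℝ)
    (ρ u : ℝ → ℝ) : Prop extends IsSmoothState 0 ρ u where
  mass : ∀ y : ℝ, 0 < y → deriv (fun s => ρ s * u s) y = 0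
  momentum : ∀ y : ℝ, 0 < y →
    ρ y * u y * deriv u y + deriv (fun s => p (ρ s)) y = deriv (deriv u) y
  density_far : Tendsto ρ atTop (𝓝 ρinf)
  velocity_far : Tendsto u atTop (𝓝 uinf)
  density_bdry : ρ 0 = ρm
  velocity_bdry : u 0 = um

/-- `(ρ, u)` is the unique pair of functions on `[a, ∞)` with the property `P`. Functions are
total in Lean, so uniqueness means equality on `[a, ∞)`. -/
def IsTheUniquePair (a : ℝ) (P : (ℝ → ℝ) → (ℝ → ℝ) → Prop) (ρ u : ℝ → ℝ) : Prop :=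
  P ρ u ∧ ∀ ρ₁ u₁ : ℝ → ℝ, P ρ₁ u₁ → EqOn ρ₁ ρ (Ici a) ∧ EqOn u₁ u (Ici a)

/-!
In terms of the specific volume `v = 1 / ρ`, conservation of mass gives `u = A v / σ`, where `σ` is
the cross-section (`r ^ (n - 1)`, or `1` for the boundary layer) and `A` the mass flux, and the
Navier–Stokes momentum balance becomes a scalar second order equation for `v`. Integrated from
infinity it reads `v' = φ F[v]`, with `φ = σ / (μ A)` and
`F[v] = A ^ 2 v / σ ^ 2 + q(v) - c - ∫_r^∞ A ^ 2 σ' v / σ ^ 3`, `q(v) = p(1 / v)` (`ductForce`). The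
integration constant `c` encodes the state at infinity. Since `q' < 0`, and the other terms of `F`
are small together with `A / σ(a)`, this is a damped equation near the constant state `1 / ρ₊`
(`isDamped_ductForce`), however large the rate `φ` is. This has three consequences.

* Duhamel's formula turns `v' = φ F[v]` into a fixed point problem for a contraction in the sup
  norm, so that solutions exist on the whole half line (`IsDamped.exists_solution`).
* Solutions cannot leave a window around `1 / ρ₊` (`mem_tube_of_ductForce`); hence uniqueness holds
  among all smooth solutions, not only among those close to the far field.
* An approximate solution with residual `e` is within `O(e)` of the solution, uniformly in `φ`
  (`IsDamped.abs_sub_le`).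

The boundary layer problem is the special case `σ = 1`, `μ = 1`, where `F` is local and the damping
gives exponential decay (`exists_boundaryLayer`). The Euler flow satisfies `F[v] = 0`
(`ductForce_eq_zero_of_inviscid`); it is found from Bernoulli's law, as the subsonic branch of an
algebraic equation (`IsPressureLaw.exists_isBernoulliBranch`). Finally, the composite approximation
`v_E(r) + v_B((r - r₀) / μ) - v_E(r₀)` solves the equation up to a residual `O(μ)`: the residual is
bounded by `μ` plus the product of `r - r₀` with the layer profile, and the latter is `O(μ)` as the
profile decays exponentially in `(r - r₀) / μ` (`abs_sub_composite_le`). Thus the error in the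
inviscid limit is even `O(μ)`.
-/

open MeasureTheory

/-! ### Barrier and growth lemmas for functions on a half line -/

/-- A function that starts below the level `c`, and decreases strictly whenever it meets that
level, stays below it. No differentiability is needed at the left endpoint. -/
theorem le_of_hasDerivAt_neg_of_eq {a c : ℝ} {f f' : ℝ → ℝ} (hf : ContinuousOn f (Ici a))
    (hd : ∀ r, a < r → HasDerivAt f (f' r) r) (ha : f a < c)
    (hc : ∀ r, a < r → f r = c → f' r < 0) : ∀ r, a ≤ r → f r ≤ c := by
  intro r hr
  rcases hr.eq_or_lt with rfl | hr
  · exact ha.le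
  have h1 : ∀ᶠ x in 𝓝[>] a, f x < c :=
    ((hf a self_mem_Ici).mono Ioi_subset_Ici_self).eventually (gt_mem_nhds ha)
  have h2 : ∀ᶠ x in 𝓝[>] a, x ∈ Ioo a r := Ioo_mem_nhdsGT hr
  obtain ⟨s, hs, has, hsr⟩ := (h1.and h2).exists
  refine image_le_of_deriv_right_lt_deriv_boundary' (a := s) (b := r) (f' := f')
    (B := fun _ => c) (B' := fun _ => 0) (hf.mono fun x hx => has.le.trans hx.1)
    (fun x hx => (hd x (has.trans_le hx.1)).hasDerivWithinAt) hs.le continuousOn_const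
    (fun x _ => hasDerivWithinAt_const _ _ _) (fun x hx h => hc x (has.trans_le hx.1) h)
    ⟨hsr.le, le_rfl⟩

theorem add_mul_sub_le_of_le_deriv {R c : ℝ} {f f' : ℝ → ℝ}
    (hd : ∀ r, R ≤ r → HasDerivAt f (f' r) r) (hc : ∀ r, R ≤ r → c ≤ f' r) :
    ∀ r, R ≤ r → f R + c * (r - R) ≤ f r := by
  intro r hr
  have h := (convex_Ici R).mul_sub_le_image_sub_of_le_deriv (f := f) (C := c)
    (fun x hx => (hd x hx).continuousAt.continuousWithinAt)
    (fun x hx => (hd x (interior_subset hx)).differentiableAt.differentiableWithinAt)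
    (fun x hx => by rw [(hd x (interior_subset hx)).deriv]; exact hc x (interior_subset hx))
    R self_mem_Ici r hr hr
  linarith

/-- A function whose derivative is eventually bounded below by a positive constant has no finite
limit. -/
theorem not_tendsto_of_le_deriv {R c l : ℝ} {f f' : ℝ → ℝ}
    (hd : ∀ r, R ≤ r → HasDerivAt f (f' r) r) (h0 : 0 < c) (hc : ∀ r, R ≤ r → c ≤ f' r) :
    ¬ Tendsto f atTop (𝓝 l) := by
  refine not_tendsto_nhds_of_tendsto_atTop (tendsto_atTop_mono' _ ?_
    (tendsto_atTop_add_const_left _ (f R)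
      ((tendsto_id.atTop_add (tendsto_const_nhds (x := -R))).const_mul_atTop h0))) l
  filter_upwards [eventually_ge_atTop R] with r hr
  simpa [sub_eq_add_neg] using add_mul_sub_le_of_le_deriv hd hc r hr

/-- If the slope of `f` is at most `-c < 0` wherever `f ≥ η` far out, then `f ≤ η` eventually. -/
theorem eventually_le_of_deriv_le_neg {R c η : ℝ} {f f' : ℝ → ℝ}
    (hd : ∀ r, R ≤ r → HasDerivAt f (f' r) r) (h0 : 0 < c)
    (hc : ∀ r, R ≤ r → η ≤ f r → f' r ≤ -c) : ∀ᶠ r in atTop, f r ≤ η := by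
  obtain ⟨s, hs, hfs⟩ : ∃ s, R ≤ s ∧ f s ≤ η := by
    by_contra! hcon
    have h1 := add_mul_sub_le_of_le_deriv (f := fun r => -f r) (f' := fun r => -f' r)
      (fun r hr => (hd r hr).neg) (fun r hr => le_neg_of_le_neg (hc r hr (hcon r hr).le))
      (R + (f R - η) / c) (by
        have := div_pos (sub_pos.2 (hcon R le_rfl)) h0
        linarith)
    have h2 := hcon (R + (f R - η) / c) (by
        have := div_pos (sub_pos.2 (hcon R le_rfl)) h0
        linarith)
    have h3 : c * (R + (f R - η) / c - R) = f R - η := by field_simp; ring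
    rw [h3] at h1
    linarith
  filter_upwards [eventually_ge_atTop s] with r hr
  exact image_le_of_deriv_right_lt_deriv_boundary' (a := s) (b := r) (f' := f')
    (B := fun _ => η) (B' := fun _ => 0)
    (fun x hx => (hd x (hs.trans hx.1)).continuousAt.continuousWithinAt)
    (fun x hx => (hd x (hs.trans hx.1)).hasDerivWithinAt) hfs continuousOn_const
    (fun x _ => hasDerivWithinAt_const _ _ _)
    (fun x hx h => by linarith [hc x (hs.trans hx.1) h.ge]) ⟨hr, le_rfl⟩

/-! ### Relaxation equations `v' = φ · 𝓕[v]` -/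

theorem le_of_relaxation {a K δ : ℝ} {φ z G : ℝ → ℝ} (hK : 0 < K)
    (hφ : ∀ r, a < r → 0 < φ r) (hz : ContinuousOn z (Ici a))
    (hd : ∀ r, a < r → HasDerivAt z (φ r * (G r - K * z r)) r)
    (hG : ∀ r, a < r → G r ≤ K * δ) (ha : z a ≤ δ) : ∀ r, a ≤ r → z r ≤ δ := by
  intro r hr
  refine le_of_forall_pos_le_add fun η hη => ?_
  refine le_of_hasDerivAt_neg_of_eq hz hd (by linarith) (fun s hs h => ?_) r hr
  have := hG s hs
  have h1 : G s - K * z s < 0 := by rw [h]; nlinarith [mul_pos hK hη]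
  exact mul_neg_of_pos_of_neg (hφ s hs) h1

/-- The damping `-K z` keeps a solution of `z' = φ (G - K z)` below `sup |G| / K`, whatever the
rate `φ` is. -/
theorem abs_le_of_relaxation {a K δ : ℝ} {φ z G : ℝ → ℝ} (hK : 0 < K)
    (hφ : ∀ r, a < r → 0 < φ r) (hz : ContinuousOn z (Ici a))
    (hd : ∀ r, a < r → HasDerivAt z (φ r * (G r - K * z r)) r)
    (hG : ∀ r, a < r → |G r| ≤ K * δ) (ha : |z a| ≤ δ) : ∀ r, a ≤ r → |z r| ≤ δ := by
  intro r hr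
  refine abs_le.2 ⟨?_, le_of_relaxation hK hφ hz hd (fun s hs => (abs_le.1 (hG s hs)).2)
    (abs_le.1 ha).2 r hr⟩
  have := le_of_relaxation (z := fun r => -z r) (G := fun r => -G r) (δ := δ) hK hφ hz.neg
    (fun s hs => by convert! (hd s hs).neg using 1; ring)
    (fun s hs => by linarith [(abs_le.1 (hG s hs)).1]) (by linarith [(abs_le.1 ha).1]) r hr
  linarith

/-- The continuous functions on `[a, ∞)` with values in `[c - δ, c + δ]`. -/
def tube (a c δ : ℝ) : Set (ℝ → ℝ) :=
  {v | ContinuousOn v (Ici a) ∧ ∀ r, a ≤ r → |v r - c| ≤ δ}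

/-- Duhamel's formula for the linear problem `z' = φ (G - K z)`, `z(a) = z₀`. -/
theorem exists_linear_relaxation (a K z₀ : ℝ) {φ G : ℝ → ℝ} (hφ : Continuous φ)
    (hG : Continuous G) :
    ∃ z : ℝ → ℝ, z a = z₀ ∧ ∀ r, HasDerivAt z (φ r * (G r - K * z r)) r := by
  set Φ : ℝ → ℝ := fun r => ∫ s in a..r, K * φ s with hΦ
  have hΦd : ∀ r, HasDerivAt Φ (K * φ r) r := fun r =>
    (hφ.const_mul K |>.integral_hasStrictDerivAt a r).hasDerivAt
  have hΦc : Continuous Φ := continuous_iff_continuousAt.2 fun r => (hΦd r).continuousAt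
  set J : ℝ → ℝ := fun r => ∫ s in a..r, Real.exp (Φ s) * (φ s * G s) with hJ
  have hJd : ∀ r, HasDerivAt J (Real.exp (Φ r) * (φ r * G r)) r := fun r =>
    ((((Real.continuous_exp.comp hΦc).mul (hφ.mul hG))).integral_hasStrictDerivAt a r).hasDerivAt
  refine ⟨fun r => Real.exp (-Φ r) * (z₀ + J r), by simp [hΦ, hJ], fun r => ?_⟩
  convert! ((hΦd r).neg.exp).mul ((hJd r).const_add z₀) using 1
  have : Real.exp (-Φ r) * Real.exp (Φ r) = 1 := by rw [← Real.exp_add]; simp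
  simp only [Pi.neg_apply]
  linear_combination -(φ r * G r) * this

/-- Hypotheses under which `v' = φ · 𝓕[v]` is a damped equation in the tube of radius `δ` about
`c`: the perturbed operator `𝓕[v] + K (v - c)` maps the tube into the ball of radius `K δ`, and it
is Lipschitz with constant `K - κ < K` for the sup distance. The operator `𝓕` may be nonlocal. -/
structure IsDamped (a c δ K κ : ℝ) (F : (ℝ → ℝ) → ℝ → ℝ) : Prop where
  radius_pos : 0 < δ
  rate_pos : 0 < κ
  rate_le : κ ≤ K
  continuousOn : ∀ v ∈ tube a c δ, ContinuousOn (F v) (Ici a)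
  bound : ∀ v ∈ tube a c δ, ∀ r, a ≤ r → |F v r + K * (v r - c)| ≤ K * δ
  contract : ∀ v ∈ tube a c δ, ∀ w ∈ tube a c δ, ∀ D, (∀ s, a ≤ s → |v s - w s| ≤ D) →
    ∀ r, a ≤ r → |F v r + K * v r - (F w r + K * w r)| ≤ (K - κ) * D

/-- Stability of damped equations: an approximate solution with residual at most `e` is within
`e / κ` of the solution, independently of the rate `φ`. -/
theorem IsDamped.abs_sub_le {a c δ K κ e : ℝ} {F : (ℝ → ℝ) → ℝ → ℝ} (hF : IsDamped a c δ K κ F)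
    {φ v w E : ℝ → ℝ} (hφ : ∀ r, a < r → 0 < φ r) (hv : v ∈ tube a c δ) (hw : w ∈ tube a c δ)
    (hvw : v a = w a) (hvd : ∀ r, a < r → HasDerivAt v (φ r * F v r) r)
    (hwd : ∀ r, a < r → HasDerivAt w (φ r * (F w r + E r)) r) (hE : ∀ r, a < r → |E r| ≤ e) :
    ∀ r, a ≤ r → |v r - w r| ≤ e / κ := by
  have hK : 0 < K := hF.rate_pos.trans_le hF.rate_le
  have he : 0 ≤ e := (abs_nonneg _).trans (hE (a + 1) (by linarith))
  have step : ∀ D, 0 ≤ D → (∀ r, a ≤ r → |v r - w r| ≤ D) →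
      ∀ r, a ≤ r → |v r - w r| ≤ ((K - κ) * D + e) / K := by
    intro D hD0 hD
    refine abs_le_of_relaxation (z := fun r => v r - w r) (φ := φ) (K := K)
      (G := fun r => F v r + K * v r - (F w r + K * w r) - E r) hK hφ (hv.1.sub hw.1) ?_ ?_ ?_
    · intro r hr
      convert! (hvd r hr).sub (hwd r hr) using 1
      ring
    · intro r hr
      have h1 := hF.contract v hv w hw D hD r hr.le
      have h2 := hE r hr
      rw [mul_div_cancel₀ _ hK.ne']
      exact (abs_sub _ _).trans (add_le_add h1 h2)
    · simp only [hvw, sub_self, abs_zero]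
      exact div_nonneg (add_nonneg (mul_nonneg (by linarith [hF.rate_le]) hD0) he) hK.le
  -- The least uniform bound `D` satisfies `K D ≤ (K - κ) D + e`.
  set S : Set ℝ := (fun r => |v r - w r|) '' Ici a
  have hne : S.Nonempty := ⟨_, a, self_mem_Ici, rfl⟩
  have hbd : BddAbove S := by
    refine ⟨δ + δ, ?_⟩
    rintro _ ⟨r, hr, rfl⟩
    have h1 := abs_le.1 (hv.2 r hr)
    have h2 := abs_le.1 (hw.2 r hr)
    exact abs_le.2 ⟨by linarith, by linarith⟩
  have hle : ∀ r, a ≤ r → |v r - w r| ≤ sSup S := fun r hr => le_csSup hbd ⟨r, hr, rfl⟩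
  have h0 : 0 ≤ sSup S := (abs_nonneg _).trans (hle a le_rfl)
  have h1 : sSup S ≤ ((K - κ) * sSup S + e) / K := by
    refine csSup_le hne ?_
    rintro _ ⟨r, hr, rfl⟩
    exact step _ h0 hle r hr
  rw [le_div_iff₀ hK] at h1
  have h2 : sSup S ≤ e / κ := by
    rw [le_div_iff₀ hF.rate_pos]; linarith
  exact fun r hr => (hle r hr).trans h2

/-- Global solvability of damped equations on a half line. The fixed point map sends `v` to the
solution `z` of the linear problem `z' = φ (𝓕[v] + K v - K z)`, where `v` is first clamped to the
tube; it is a contraction for the sup distance, with ratio `1 - κ / K`. -/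
theorem IsDamped.exists_solution {a c δ K κ v₀ : ℝ} {F : (ℝ → ℝ) → ℝ → ℝ}
    (hF : IsDamped a c δ K κ F) {φ : ℝ → ℝ} (hφc : ContinuousOn φ (Ici a))
    (hφ : ∀ r, a ≤ r → 0 < φ r) (h0 : |v₀ - c| ≤ δ) :
    ∃ v ∈ tube a c δ, v a = v₀ ∧
      ∀ r, a ≤ r → HasDerivWithinAt v (φ r * F v r) (Ici a) r := by
  have hK : 0 < K := hF.rate_pos.trans_le hF.rate_le
  have hδ := hF.radius_pos
  have hmax : Continuous fun r : ℝ => max a r := continuous_const.max continuous_id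
  have hext : ∀ f : ℝ → ℝ, ContinuousOn f (Ici a) → Continuous fun r => f (max a r) :=
    fun f hf => hf.comp_continuous hmax fun r => mem_Ici.2 (le_max_left a r)
  let clamp : ℝ → ℝ := fun x => max (c - δ) (min (c + δ) x)
  have hclc : Continuous clamp := continuous_const.max (continuous_const.min continuous_id)
  have hcl : ∀ x, |clamp x - c| ≤ δ := fun x => abs_le.2
    ⟨by linarith [le_max_left (c - δ) (min (c + δ) x)], by
      have : clamp x ≤ c + δ := max_le (by linarith) (min_le_left _ _)
      linarith⟩
  have hcl1 : ∀ x y, |clamp x - clamp y| ≤ |x - y| := fun x y =>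
    (abs_max_sub_max_le_max _ _ _ _).trans (max_le (by simp) <|
      (abs_min_sub_min_le_max _ _ _ _).trans (max_le (by simp) le_rfl))
  have hcl2 : ∀ x, |x - c| ≤ δ → clamp x = x := fun x hx => by
    have := abs_le.1 hx
    rw [show clamp x = max (c - δ) (min (c + δ) x) from rfl, min_eq_right (by linarith),
      max_eq_right (by linarith)]
  have htube : ∀ v : BoundedContinuousFunction ℝ ℝ, (fun r => clamp (v r)) ∈ tube a c δ :=
    fun v => ⟨(hclc.comp v.continuous).continuousOn, fun r _ => hcl _⟩
  let G : BoundedContinuousFunction ℝ ℝ → ℝ → ℝ := fun v r =>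
    F (fun r => clamp (v r)) (max a r) + K * (clamp (v (max a r)) - c)
  have hGc : ∀ v, Continuous (G v) := fun v =>
    (hext _ (hF.continuousOn _ (htube v))).add
      ((((hclc.comp v.continuous).comp hmax).sub continuous_const).const_mul K)
  have hGb : ∀ v r, |G v r| ≤ K * δ := fun v r => hF.bound _ (htube v) _ (le_max_left _ _)
  have hφ' := hext φ hφc
  choose Z hZa hZd using fun v : BoundedContinuousFunction ℝ ℝ =>
    exists_linear_relaxation a K (v₀ - c) hφ' (hGc v)
  have hZc : ∀ v, Continuous (Z v) := fun v =>
    continuous_iff_continuousAt.2 fun r => (hZd v r).continuousAt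
  have hφ'' : ∀ r, a < r → 0 < φ (max a r) := fun r hr => hφ _ (le_max_left _ _)
  have hZb : ∀ v r, a ≤ r → |Z v r| ≤ δ := fun v => abs_le_of_relaxation hK hφ''
    (hZc v).continuousOn (fun r _ => hZd v r) (fun r _ => hGb v r) (by rw [hZa]; exact h0)
  let T : BoundedContinuousFunction ℝ ℝ → BoundedContinuousFunction ℝ ℝ := fun v =>
    BoundedContinuousFunction.ofNormedAddCommGroup (fun r => c + Z v (max a r))
      (continuous_const.add ((hZc v).comp hmax)) (|c| + δ) fun r =>
        (norm_add_le _ _).trans (add_le_add le_rfl (hZb v _ (le_max_left _ _)))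
  have hT : ∀ v r, T v r = c + Z v (max a r) := fun v r => rfl
  have hcontr : ContractingWith (Real.toNNReal ((K - κ) / K)) T := by
    refine ⟨?_, LipschitzWith.of_dist_le_mul fun v w => ?_⟩
    · rw [Real.toNNReal_lt_one, div_lt_one hK]; linarith [hF.rate_pos]
    · rw [Real.coe_toNNReal _ (div_nonneg (by linarith [hF.rate_le]) hK.le)]
      have hnn : 0 ≤ (K - κ) / K * dist v w :=
        mul_nonneg (div_nonneg (by linarith [hF.rate_le]) hK.le) dist_nonneg
      refine (BoundedContinuousFunction.dist_le hnn).2 fun r => ?_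
      rw [hT, hT, Real.dist_eq, add_sub_add_left_eq_sub]
      refine abs_le_of_relaxation (z := fun r => Z v r - Z w r)
        (G := fun r => G v r - G w r) hK hφ'' ((hZc v).sub (hZc w)).continuousOn
        (fun s _ => ?_) (fun s _ => ?_) ?_ _ (le_max_left _ _)
      · convert! (hZd v s).sub (hZd w s) using 1; ring
      · have := hF.contract _ (htube v) _ (htube w) (dist v w) (fun t _ => (hcl1 _ _).trans
          (by rw [← Real.dist_eq]; exact BoundedContinuousFunction.dist_coe_le_dist t)) (max a s)
          (le_max_left _ _)
        calc |G v s - G w s| = _ := by congr 1; simp only [G]; ring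
          _ ≤ _ := this
          _ = _ := by field_simp
      · simpa [hZa] using hnn
  set v := ContractingWith.fixedPoint T hcontr
  have hfix : T v = v := hcontr.fixedPoint_isFixedPt
  have hv : ∀ r, v r = c + Z v (max a r) := fun r => by rw [← hT, hfix]
  have hvb : ∀ r, |v r - c| ≤ δ := fun r => by
    rw [hv, add_sub_cancel_left]; exact hZb _ _ (le_max_left _ _)
  have hclv : (fun r => clamp (v r)) = v := funext fun r => hcl2 _ (hvb r)
  refine ⟨v, ⟨v.continuous.continuousOn, fun r _ => hvb r⟩, by rw [hv]; simp [hZa], ?_⟩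
  intro r hr
  have h1 : HasDerivWithinAt (fun s => c + Z v s) (φ r * F v r) (Ici a) r := by
    have h2 := ((hZd v r).const_add c).hasDerivWithinAt (s := Ici a)
    convert! h2 using 1
    have h3 := hv r
    simp only [G, max_eq_right hr, hclv] at h3 ⊢
    rw [hcl2 _ (hvb r), h3]; ring
  refine h1.congr (fun s hs => ?_) ?_
  · rw [hv, max_eq_right hs]
  · rw [hv, max_eq_right hr]

/-! ### Integrals over the tail `(r, ∞)` -/

theorem tail_eq_sub {a : ℝ} {g : ℝ → ℝ} (hi : IntegrableOn g (Ioi a)) {r : ℝ} (hr : a ≤ r) :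
    ∫ s in Ioi r, g s = (∫ s in Ioi a, g s) - ∫ s in a..r, g s := by
  rw [← intervalIntegral.integral_interval_add_Ioi (b := r) hi (hi.mono_set (Ioi_subset_Ioi hr))]
  ring

theorem tendsto_tail {a : ℝ} {g : ℝ → ℝ} (hi : IntegrableOn g (Ioi a)) :
    Tendsto (fun r => ∫ s in Ioi r, g s) atTop (𝓝 0) := by
  have h := (intervalIntegral_tendsto_integral_Ioi a hi tendsto_id).const_sub (∫ s in Ioi a, g s)
  rw [sub_self] at h
  refine h.congr' ?_
  filter_upwards [eventually_ge_atTop a] with r hr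
  exact (tail_eq_sub hi hr).symm

theorem hasDerivWithinAt_tail {a : ℝ} {g : ℝ → ℝ} (hg : ContinuousOn g (Ici a))
    (hi : IntegrableOn g (Ioi a)) {r : ℝ} (hr : a ≤ r) :
    HasDerivWithinAt (fun r => ∫ s in Ioi r, g s) (-g r) (Ici a) r := by
  have hc : Continuous fun r => g (max a r) :=
    hg.comp_continuous (continuous_const.max continuous_id) fun r => mem_Ici.2 (le_max_left a r)
  have h := ((hc.integral_hasStrictDerivAt a r).hasDerivAt.const_sub
    (∫ s in Ioi a, g s)).hasDerivWithinAt (s := Ici a)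
  rw [max_eq_right hr] at h
  have key : ∀ x, a ≤ x → ∫ s in Ioi x, g s = (∫ s in Ioi a, g s) - ∫ s in a..x, g (max a s) := by
    intro x hx
    rw [tail_eq_sub hi hx]
    congr 1
    refine intervalIntegral.integral_congr fun s hs => ?_
    rw [uIcc_of_le hx] at hs
    simp only [max_eq_right hs.1]
  exact h.congr (fun x hx => key x hx) (key r hr)

/-! ### Flow in a duct of slowly varying cross-section -/

/-- A smooth cross-section `σ` on `[a, ∞)`, positive and nondecreasing, whose reciprocal has
the limit `τ` at infinity. The radial problems use `σ(r) = r ^ (n - 1)` with `τ = 0`, the boundary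
layer problem uses `σ = 1` with `τ = 1`. -/
structure IsDuct (a τ : ℝ) (σ : ℝ → ℝ) : Prop where
  smooth : ContDiff ℝ ∞ σ
  pos : ∀ r, a ≤ r → 0 < σ r
  mono : ∀ r, a ≤ r → 0 ≤ deriv σ r
  lim : Tendsto (fun r => (σ r)⁻¹) atTop (𝓝 τ)

/-- The viscous force `μ A v' / σ` in a duct with mass flux `A`, in terms of the specific volume
`v = 1 / ρ` and the pressure `q` as a function of `v`. It is the momentum balance
`(A / σ) (A v / σ)' + q(v)' = (μ A v' / σ)'`, integrated from infinity; the nonlocal term arises as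
`(A / σ) (A v / σ)' = (A ^ 2 v / σ ^ 2)' + A ^ 2 σ' v / σ ^ 3`. -/
noncomputable def ductForce (σ : ℝ → ℝ) (A c : ℝ) (q v : ℝ → ℝ) (r : ℝ) : ℝ :=
  A ^ 2 / σ r ^ 2 * v r + q (v r) - c - ∫ s in Ioi r, A ^ 2 * deriv σ s / σ s ^ 3 * v s

namespace IsDuct

variable {a τ : ℝ} {σ : ℝ → ℝ}

theorem hasDerivAt (hσ : IsDuct a τ σ) (r : ℝ) : HasDerivAt σ (deriv σ r) r :=
  (hσ.smooth.differentiable (by simp) r).hasDerivAt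

theorem continuous_deriv (hσ : IsDuct a τ σ) : Continuous (deriv σ) :=
  hσ.smooth.continuous_deriv (by simp)

theorem le_apply (hσ : IsDuct a τ σ) {r : ℝ} (hr : a ≤ r) : σ a ≤ σ r :=
  monotoneOn_of_deriv_nonneg (convex_Ici a) hσ.smooth.continuous.continuousOn
    (fun x _ => (hσ.hasDerivAt x).differentiableAt.differentiableWithinAt)
    (fun x hx => hσ.mono x (interior_subset hx)) self_mem_Ici hr hr

theorem hasDerivAt_coeff (hσ : IsDuct a τ σ) (A : ℝ) {r : ℝ} (hr : a ≤ r) :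
    HasDerivAt (fun r => A ^ 2 / σ r ^ 2) (-2 * (A ^ 2 * deriv σ r / σ r ^ 3)) r := by
  have h := (hσ.pos r hr).ne'
  convert! (hasDerivAt_const r (A ^ 2)).div ((hσ.hasDerivAt r).pow 2) (pow_ne_zero 2 h) using 1
  field_simp
  simp
  ring

theorem tendsto_coeff (hσ : IsDuct a τ σ) (A : ℝ) :
    Tendsto (fun r => A ^ 2 / σ r ^ 2) atTop (𝓝 (A ^ 2 * τ ^ 2)) := by
  simpa [div_eq_mul_inv] using (hσ.lim.pow 2).const_mul (A ^ 2)

theorem coeff_le (hσ : IsDuct a τ σ) (A : ℝ) {r : ℝ} (hr : a ≤ r) :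
    A ^ 2 / σ r ^ 2 ≤ A ^ 2 / σ a ^ 2 := by
  have h0 := hσ.pos a le_rfl
  have h1 := hσ.le_apply hr
  gcongr

theorem coeff_nonneg (_hσ : IsDuct a τ σ) (A r : ℝ) : 0 ≤ A ^ 2 / σ r ^ 2 := by positivity

theorem kernel_nonneg (hσ : IsDuct a τ σ) (A : ℝ) {r : ℝ} (hr : a ≤ r) :
    0 ≤ A ^ 2 * deriv σ r / σ r ^ 3 :=
  div_nonneg (mul_nonneg (sq_nonneg A) (hσ.mono r hr)) (pow_nonneg (hσ.pos r hr).le 3)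

theorem continuousOn_kernel (hσ : IsDuct a τ σ) (A : ℝ) :
    ContinuousOn (fun r => A ^ 2 * deriv σ r / σ r ^ 3) (Ici a) :=
  (hσ.continuous_deriv.const_mul _).continuousOn.div
    (hσ.smooth.continuous.pow 3).continuousOn fun r hr => pow_ne_zero 3 (hσ.pos r hr).ne'

theorem integrableOn_kernel (hσ : IsDuct a τ σ) (A : ℝ) :
    IntegrableOn (fun r => A ^ 2 * deriv σ r / σ r ^ 3) (Ioi a) := by
  have h := (integrableOn_Ioi_deriv_of_nonpos' (a := a)
    (fun x hx => hσ.hasDerivAt_coeff A hx)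
    (fun x hx => by nlinarith [hσ.kernel_nonneg A (le_of_lt (mem_Ioi.1 hx))])
    (hσ.tendsto_coeff A)).const_mul (-1 / 2)
  refine h.congr (ae_of_all _ fun x => ?_)
  ring

theorem integral_kernel_le (hσ : IsDuct a τ σ) (A : ℝ) {r : ℝ} (hr : a ≤ r) :
    ∫ s in Ioi r, A ^ 2 * deriv σ s / σ s ^ 3 ≤ A ^ 2 / σ a ^ 2 / 2 := by
  have h := integral_Ioi_of_hasDerivAt_of_nonpos' (a := r)
    (fun x hx => hσ.hasDerivAt_coeff A (hr.trans hx))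
    (fun x hx => by nlinarith [hσ.kernel_nonneg A (hr.trans (le_of_lt (mem_Ioi.1 hx)))])
    (hσ.tendsto_coeff A)
  rw [integral_const_mul] at h
  have h1 := hσ.coeff_le A hr
  have h2 : 0 ≤ A ^ 2 * τ ^ 2 := by positivity
  linarith

theorem integrableOn_kernel_mul (hσ : IsDuct a τ σ) (A : ℝ) {v : ℝ → ℝ} {B : ℝ}
    (hv : ContinuousOn v (Ici a)) (hb : ∀ r, a ≤ r → |v r| ≤ B) :
    IntegrableOn (fun s => A ^ 2 * deriv σ s / σ s ^ 3 * v s) (Ioi a) := by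
  refine (hσ.integrableOn_kernel A).mul_bdd (c := B)
    ((hv.mono Ioi_subset_Ici_self).aestronglyMeasurable measurableSet_Ioi) ?_
  exact (ae_restrict_iff' measurableSet_Ioi).2 (ae_of_all _ fun x hx => hb x (le_of_lt hx))

theorem abs_integral_kernel_mul_le (hσ : IsDuct a τ σ) (A : ℝ) {v : ℝ → ℝ} {B : ℝ}
    (hB : 0 ≤ B) (hb : ∀ r, a ≤ r → |v r| ≤ B) {r : ℝ} (hr : a ≤ r) :
    |∫ s in Ioi r, A ^ 2 * deriv σ s / σ s ^ 3 * v s| ≤ A ^ 2 / σ a ^ 2 / 2 * B := by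
  have h := norm_integral_le_of_norm_le
    (((hσ.integrableOn_kernel A).mono_set (Ioi_subset_Ioi hr)).mul_const B)
    (f := fun s => A ^ 2 * deriv σ s / σ s ^ 3 * v s)
    ((ae_restrict_iff' measurableSet_Ioi).2 (ae_of_all _ fun x hx => by
      have hx' : a ≤ x := hr.trans (le_of_lt hx)
      rw [norm_mul, Real.norm_eq_abs, abs_of_nonneg (hσ.kernel_nonneg A hx')]
      exact mul_le_mul_of_nonneg_left (hb x hx') (hσ.kernel_nonneg A hx')))
  rw [integral_mul_const] at h
  exact h.trans (mul_le_mul_of_nonneg_right (hσ.integral_kernel_le A hr) hB)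

end IsDuct

/-- A window `[c - δ, c + δ]` of specific volumes on which the pressure `q` decreases with a slope
between `-K` and `-ν`, and has an `M`-Lipschitz derivative. -/
structure IsPressureWindow (q : ℝ → ℝ) (c δ ν K M : ℝ) : Prop where
  radius_pos : 0 < δ
  radius_le : δ ≤ c / 2
  slope_pos : 0 < ν
  slope_le : ν ≤ K
  smooth : ContDiffOn ℝ ∞ q (Ioi 0)
  deriv_mem : ∀ x, |x - c| ≤ δ → deriv q x ∈ Icc (-K) (-ν)
  lipschitz : ∀ x y, |x - c| ≤ δ → |y - c| ≤ δ → |deriv q x - deriv q y| ≤ M * |x - y|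

namespace IsPressureWindow

variable {q : ℝ → ℝ} {c δ ν K M : ℝ}

theorem pos (hq : IsPressureWindow q c δ ν K M) {x : ℝ} (hx : |x - c| ≤ δ) : 0 < x := by
  have := (abs_le.1 hx).1
  have := hq.radius_pos
  have := hq.radius_le
  linarith

theorem le_of_mem (hq : IsPressureWindow q c δ ν K M) {x : ℝ} (hx : |x - c| ≤ δ) :
    c / 2 ≤ x ∧ x ≤ 3 / 2 * c := by
  have := abs_le.1 hx
  have := hq.radius_le
  constructor <;> linarith

theorem hasDerivAt_of_pos (hq : IsPressureWindow q c δ ν K M) {x : ℝ} (hx : 0 < x) :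
    HasDerivAt q (deriv q x) x :=
  ((hq.smooth.differentiableOn (by simp)).differentiableAt (Ioi_mem_nhds hx)).hasDerivAt

theorem hasDerivAt (hq : IsPressureWindow q c δ ν K M) {x : ℝ} (hx : |x - c| ≤ δ) :
    HasDerivAt q (deriv q x) x := hq.hasDerivAt_of_pos (hq.pos hx)

theorem mem_of_mem_Icc {x y z : ℝ} (hx : |x - c| ≤ δ) (hy : |y - c| ≤ δ) (hz : z ∈ Icc x y) :
    |z - c| ≤ δ := by
  have h1 := abs_le.1 hx
  have h2 := abs_le.1 hy
  exact abs_le.2 ⟨by linarith [hz.1], by linarith [hz.2]⟩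

theorem mem_sub (hq : IsPressureWindow q c δ ν K M) {x y : ℝ} (hx : |x - c| ≤ δ)
    (hy : |y - c| ≤ δ) (hxy : x ≤ y) : ν * (y - x) ≤ q x - q y ∧ q x - q y ≤ K * (y - x) := by
  have hm := fun z (hz : z ∈ Icc x y) => mem_of_mem_Icc hx hy hz
  have hc : ContinuousOn q (Icc x y) := fun z hz =>
    (hq.hasDerivAt (hm z hz)).continuousAt.continuousWithinAt
  have hd : DifferentiableOn ℝ q (interior (Icc x y)) := fun z hz =>
    (hq.hasDerivAt (hm z (interior_subset hz))).differentiableAt.differentiableWithinAt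
  have h1 := (convex_Icc x y).image_sub_le_mul_sub_of_deriv_le hc hd (C := -ν)
    (fun z hz => (hq.deriv_mem z (hm z (interior_subset hz))).2) x ⟨le_rfl, hxy⟩ y ⟨hxy, le_rfl⟩ hxy
  have h2 := (convex_Icc x y).mul_sub_le_image_sub_of_le_deriv hc hd (C := -K)
    (fun z hz => (hq.deriv_mem z (hm z (interior_subset hz))).1) x ⟨le_rfl, hxy⟩ y ⟨hxy, le_rfl⟩ hxy
  constructor <;> linarith

theorem abs_sub_le (hq : IsPressureWindow q c δ ν K M) {x y : ℝ} (hx : |x - c| ≤ δ)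
    (hy : |y - c| ≤ δ) : |q x - q y| ≤ K * |x - y| := by
  wlog h : x ≤ y generalizing x y
  · rw [abs_sub_comm, abs_sub_comm x]
    exact this hy hx (le_of_not_ge h)
  have h1 := hq.mem_sub hx hy h
  have h2 := mul_nonneg hq.slope_pos.le (sub_nonneg.2 h)
  rw [abs_of_nonpos (sub_nonpos.2 h), abs_of_nonneg (by linarith)]
  linarith [h1.2]

theorem abs_add_mul_sub_le (hq : IsPressureWindow q c δ ν K M) {x y : ℝ} (hx : |x - c| ≤ δ)
    (hy : |y - c| ≤ δ) : |q x + K * x - (q y + K * y)| ≤ (K - ν) * |x - y| := by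
  have hK := hq.slope_le
  rcases le_total x y with h | h
  · have := hq.mem_sub hx hy h
    rw [abs_of_nonpos (sub_nonpos.2 h)]
    exact abs_le.2 ⟨by linarith, by linarith⟩
  · have := hq.mem_sub hy hx h
    rw [abs_of_nonneg (sub_nonneg.2 h)]
    exact abs_le.2 ⟨by linarith, by linarith⟩

theorem lipschitz_nonneg (hq : IsPressureWindow q c δ ν K M) : 0 ≤ M := by
  have hδ := hq.radius_pos
  have h := (abs_nonneg _).trans
    (hq.lipschitz c (c + δ) (by simpa using hδ.le) (by simp [abs_of_pos hδ]))
  rw [show c - (c + δ) = -δ by ring, abs_neg, abs_of_pos hδ] at h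
  exact nonneg_of_mul_nonneg_left h hδ

/-- A second difference of `q` is bounded by the product of the two increments. -/
theorem abs_second_diff_le (hq : IsPressureWindow q c δ ν K M) {x y d : ℝ} (hx : |x - c| ≤ δ)
    (hy : |y - c| ≤ δ) (hxd : |x + d - c| ≤ δ) (hyd : |y + d - c| ≤ δ) :
    |q (x + d) - q x - (q (y + d) - q y)| ≤ M * |x - y| * |d| := by
  have hseg : ∀ z, |z - c| ≤ δ → |z + d - c| ≤ δ → ∀ t ∈ uIcc 0 d, |z + t - c| ≤ δ := by
    intro z hz hzd t ht
    rcases le_total 0 d with h | h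
    · rw [uIcc_of_le h] at ht
      exact mem_of_mem_Icc hz hzd ⟨by linarith [ht.1], by linarith [ht.2]⟩
    · rw [uIcc_of_ge h] at ht
      exact mem_of_mem_Icc hzd hz ⟨by linarith [ht.1], by linarith [ht.2]⟩
  have h := (convex_uIcc (0 : ℝ) d).norm_image_sub_le_of_norm_hasDerivWithin_le
    (f := fun t => q (x + t) - q (y + t))
    (f' := fun t => deriv q (x + t) - deriv q (y + t)) (C := M * |x - y|)
    (fun t ht => (((hq.hasDerivAt (hseg x hx hxd t ht)).comp_const_add x t).sub
      ((hq.hasDerivAt (hseg y hy hyd t ht)).comp_const_add y t)).hasDerivWithinAt)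
    (fun t ht => by
      have := hq.lipschitz _ _ (hseg x hx hxd t ht) (hseg y hy hyd t ht)
      rwa [add_sub_add_right_eq_sub] at this) left_mem_uIcc right_mem_uIcc
  simp only [Real.norm_eq_abs, add_zero, sub_zero] at h
  calc _ = _ := by congr 1; ring
    _ ≤ _ := h

end IsPressureWindow

/-! ### The integrated momentum balance as a damped equation -/

section Duct

variable {a τ : ℝ} {σ : ℝ → ℝ} {q : ℝ → ℝ} {vb δ ν K M A c : ℝ}

theorem hasDerivWithinAt_ductForce (hσ : IsDuct a τ σ) {v : ℝ → ℝ} {B v' q' r : ℝ}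
    (hv : ContinuousOn v (Ici a)) (hB : ∀ r, a ≤ r → |v r| ≤ B) (hr : a ≤ r)
    (hd : HasDerivWithinAt v v' (Ici a) r) (hq : HasDerivAt q q' (v r)) :
    HasDerivWithinAt (ductForce σ A c q v)
      ((A ^ 2 / σ r ^ 2 + q') * v' - A ^ 2 * deriv σ r / σ r ^ 3 * v r) (Ici a) r := by
  have h1 := (hσ.hasDerivAt_coeff A hr).hasDerivWithinAt (s := Ici a)
  have h2 := hasDerivWithinAt_tail ((hσ.continuousOn_kernel A).mul hv)
    (hσ.integrableOn_kernel_mul A hv hB) hr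
  convert! (((h1.mul hd).add (hq.comp_hasDerivWithinAt r hd)).sub_const c).sub h2 using 1
  simp only [Pi.mul_apply]
  ring

theorem hasDerivAt_ductForce (hσ : IsDuct a τ σ) {v : ℝ → ℝ} {B v' q' r : ℝ}
    (hv : ContinuousOn v (Ici a)) (hB : ∀ r, a ≤ r → |v r| ≤ B) (hr : a < r)
    (hd : HasDerivAt v v' r) (hq : HasDerivAt q q' (v r)) :
    HasDerivAt (ductForce σ A c q v)
      ((A ^ 2 / σ r ^ 2 + q') * v' - A ^ 2 * deriv σ r / σ r ^ 3 * v r) r :=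
  (hasDerivWithinAt_ductForce hσ hv hB hr.le hd.hasDerivWithinAt hq).hasDerivAt
    (Ici_mem_nhds hr)

theorem continuousOn_ductForce (hσ : IsDuct a τ σ) {v : ℝ → ℝ} {B : ℝ}
    (hq : ContinuousOn q (Ioi 0)) (hv : ContinuousOn v (Ici a)) (h0 : ∀ r, a ≤ r → 0 < v r)
    (hB : ∀ r, a ≤ r → |v r| ≤ B) : ContinuousOn (ductForce σ A c q v) (Ici a) := by
  have h2 : ContinuousOn (fun r => ∫ s in Ioi r, A ^ 2 * deriv σ s / σ s ^ 3 * v s) (Ici a) :=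
    fun r hr => (hasDerivWithinAt_tail ((hσ.continuousOn_kernel A).mul hv)
      (hσ.integrableOn_kernel_mul A hv hB) hr).continuousWithinAt
  have h1 : ContinuousOn (fun r => A ^ 2 / σ r ^ 2) (Ici a) := fun r hr =>
    (hσ.hasDerivAt_coeff A hr).continuousAt.continuousWithinAt
  exact (((h1.mul hv).add (hq.comp hv fun r hr => h0 r hr)).sub continuousOn_const).sub h2

theorem IsPressureWindow.abs_le_of_mem_tube (hq : IsPressureWindow q vb δ ν K M) {v : ℝ → ℝ}
    (hv : v ∈ tube a vb δ) : ∀ r, a ≤ r → |v r| ≤ 3 / 2 * vb := fun r hr => by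
  rw [abs_of_pos (hq.pos (hv.2 r hr))]
  exact (hq.le_of_mem (hv.2 r hr)).2

theorem IsPressureWindow.center_pos (hq : IsPressureWindow q vb δ ν K M) : 0 < vb := by
  have := hq.radius_pos
  have := hq.radius_le
  linarith

/-- For small mass flux the inertial terms are dominated by the pressure. -/
theorem IsPressureWindow.coeff_le (hq : IsPressureWindow q vb δ ν K M)
    (hs : A ^ 2 / σ a ^ 2 * vb ≤ ν * δ / 16) : A ^ 2 / σ a ^ 2 ≤ ν / 32 := by
  have h0 := hq.center_pos
  have h1 := hq.radius_le
  have h2 := hq.slope_pos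
  refine le_of_mul_le_mul_right (hs.trans ?_) h0
  nlinarith

theorem isDamped_ductForce (hσ : IsDuct a τ σ) (hq : IsPressureWindow q vb δ ν K M)
    (hs : A ^ 2 / σ a ^ 2 * vb ≤ ν * δ / 16) (hc : |q vb - c| ≤ ν * δ / 8) :
    IsDamped a vb δ K (ν / 2) (ductForce σ A c q) where
  radius_pos := hq.radius_pos
  rate_pos := half_pos hq.slope_pos
  rate_le := by linarith [hq.slope_le, hq.slope_pos]
  continuousOn v hv := continuousOn_ductForce hσ hq.smooth.continuousOn hv.1
    (fun r hr => hq.pos (hv.2 r hr)) (hq.abs_le_of_mem_tube hv)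
  bound v hv r hr := by
    have h0 := hq.center_pos
    have hδ := hq.radius_pos
    have h1 := hq.abs_add_mul_sub_le (hv.2 r hr) (y := vb) (by simpa using hδ.le)
    have h2 := hσ.abs_integral_kernel_mul_le A (by positivity) (hq.abs_le_of_mem_tube hv) hr
    have h3 : |A ^ 2 / σ r ^ 2 * v r| ≤ A ^ 2 / σ a ^ 2 * (3 / 2 * vb) := by
      rw [abs_mul, abs_of_nonneg (hσ.coeff_nonneg A r)]
      exact mul_le_mul (hσ.coeff_le A hr) (hq.abs_le_of_mem_tube hv r hr) (abs_nonneg _)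
        (hσ.coeff_nonneg A a)
    have h4 : (K - ν) * |v r - vb| ≤ (K - ν) * δ :=
      mul_le_mul_of_nonneg_left (hv.2 r hr) (by linarith [hq.slope_le])
    have e1 := abs_le.1 (h1.trans h4)
    have e2 := abs_le.1 h2
    have e3 := abs_le.1 h3
    have e4 := abs_le.1 hc
    have := mul_pos hq.slope_pos hδ
    unfold ductForce
    refine abs_le.2 ⟨?_, ?_⟩ <;> linarith
  contract v hv w hw D hD r hr := by
    have hD0 : 0 ≤ D := (abs_nonneg _).trans (hD r hr)
    have h1 := (hq.abs_add_mul_sub_le (hv.2 r hr) (hw.2 r hr)).trans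
      (mul_le_mul_of_nonneg_left (hD r hr) (by linarith [hq.slope_le]))
    have h2 := hσ.abs_integral_kernel_mul_le A hD0 hD hr
    have h3 : |A ^ 2 / σ r ^ 2 * (v r - w r)| ≤ A ^ 2 / σ a ^ 2 * D := by
      rw [abs_mul, abs_of_nonneg (hσ.coeff_nonneg A r)]
      exact mul_le_mul (hσ.coeff_le A hr) (hD r hr) (abs_nonneg _) (hσ.coeff_nonneg A a)
    have h4 : ∫ s in Ioi r, A ^ 2 * deriv σ s / σ s ^ 3 * (v s - w s) =
        (∫ s in Ioi r, A ^ 2 * deriv σ s / σ s ^ 3 * v s) -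
          ∫ s in Ioi r, A ^ 2 * deriv σ s / σ s ^ 3 * w s := by
      rw [← integral_sub]
      · simp only [mul_sub]
      · exact (hσ.integrableOn_kernel_mul A hv.1 (hq.abs_le_of_mem_tube hv)).mono_set
          (Ioi_subset_Ioi hr)
      · exact (hσ.integrableOn_kernel_mul A hw.1 (hq.abs_le_of_mem_tube hw)).mono_set
          (Ioi_subset_Ioi hr)
    rw [h4] at h2
    have h5 := mul_le_mul_of_nonneg_right (hq.coeff_le hs) hD0
    have e1 := abs_le.1 h1
    have e2 := abs_le.1 h2
    have e3 := abs_le.1 h3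
    have := mul_nonneg hq.slope_pos.le hD0
    unfold ductForce
    refine abs_le.2 ⟨?_, ?_⟩ <;> linarith

/-- A solution that starts inside the pressure window stays there. At the upper end of the window
the force is negative, as the nonlocal term has a favourable sign; once `v` is known to be bounded
above, the nonlocal term is small and the force is positive at the lower end. -/
theorem mem_tube_of_ductForce (hσ : IsDuct a τ σ) (hq : IsPressureWindow q vb δ ν K M)
    (hs : A ^ 2 / σ a ^ 2 * vb ≤ ν * δ / 16) (hc : |q vb - c| ≤ ν * δ / 8) {φ v : ℝ → ℝ}
    (hφ : ∀ r, a < r → 0 < φ r) (hv : ContinuousOn v (Ici a)) (h0 : ∀ r, a ≤ r → 0 < v r)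
    (hd : ∀ r, a < r → HasDerivAt v (φ r * ductForce σ A c q v r) r) (ha : |v a - vb| < δ) :
    v ∈ tube a vb δ := by
  have hvb := hq.center_pos
  have hδ := hq.radius_pos
  have hδ' := hq.radius_le
  have hνδ := mul_pos hq.slope_pos hδ
  have e4 := abs_le.1 hc
  have up : ∀ r, a ≤ r → v r ≤ vb + δ := by
    refine le_of_hasDerivAt_neg_of_eq hv hd (by linarith [(abs_lt.1 ha).2]) fun r hr hvr => ?_
    refine mul_neg_of_pos_of_neg (hφ r hr) ?_
    have hN : 0 ≤ ∫ s in Ioi r, A ^ 2 * deriv σ s / σ s ^ 3 * v s :=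
      setIntegral_nonneg measurableSet_Ioi fun s hs =>
        mul_nonneg (hσ.kernel_nonneg A (hr.le.trans (le_of_lt hs)))
          (h0 s (hr.le.trans (le_of_lt hs))).le
    have h1 := (hq.mem_sub (x := vb) (y := vb + δ) (by simpa using hδ.le)
      (by simp [abs_of_pos hδ]) (by linarith)).1
    have h2 : A ^ 2 / σ r ^ 2 * (vb + δ) ≤ A ^ 2 / σ a ^ 2 * (3 / 2 * vb) :=
      mul_le_mul (hσ.coeff_le A hr.le) (by linarith) (by linarith) (hσ.coeff_nonneg A a)
    unfold ductForce
    rw [hvr]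
    linarith
  have hB : ∀ r, a ≤ r → |v r| ≤ 3 / 2 * vb := fun r hr => by
    rw [abs_of_pos (h0 r hr)]; linarith [up r hr]
  have lo : ∀ r, a ≤ r → -v r ≤ -(vb - δ) := by
    refine le_of_hasDerivAt_neg_of_eq (f := fun r => -v r) hv.neg (fun r hr => (hd r hr).neg)
      (by linarith [(abs_lt.1 ha).1]) fun r hr hvr => ?_
    refine neg_neg_of_pos (mul_pos (hφ r hr) ?_)
    have hN := (abs_le.1 (hσ.abs_integral_kernel_mul_le A (by positivity) hB hr.le)).2
    have h1 := (hq.mem_sub (x := vb - δ) (y := vb) (by simp [abs_of_pos hδ])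
      (by simpa using hδ.le) (by linarith)).1
    have h2 : 0 ≤ A ^ 2 / σ r ^ 2 * (vb - δ) :=
      mul_nonneg (hσ.coeff_nonneg A r) (by linarith)
    have hvr' : v r = vb - δ := by linarith
    unfold ductForce
    rw [hvr']
    linarith
  exact ⟨hv, fun r hr => abs_le.2 ⟨by linarith [lo r hr], by linarith [up r hr]⟩⟩

/-- Solutions in the pressure window converge to the state `w` selected by the constant `c`. -/
theorem tendsto_of_ductForce (hσ : IsDuct a τ σ) (hq : IsPressureWindow q vb δ ν K M)
    (hs : A ^ 2 / σ a ^ 2 * vb ≤ ν * δ / 16) {w : ℝ} (hw : |w - vb| ≤ δ)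
    (hc : c = A ^ 2 * τ ^ 2 * w + q w) {φ v : ℝ → ℝ} {φ₀ : ℝ} (hφ₀ : 0 < φ₀)
    (hφ : ∀ r, a < r → φ₀ ≤ φ r) (hv : v ∈ tube a vb δ)
    (hd : ∀ r, a < r → HasDerivAt v (φ r * ductForce σ A c q v r) r) :
    Tendsto v atTop (𝓝 w) := by
  have hvb := hq.center_pos
  have hν := hq.slope_pos
  have hB := hq.abs_le_of_mem_tube hv
  have hcoef : A ^ 2 * τ ^ 2 ≤ ν / 32 := by
    refine (le_of_tendsto (hσ.tendsto_coeff A) ?_).trans (hq.coeff_le hs)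
    filter_upwards [eventually_ge_atTop a] with r hr using hσ.coeff_le A hr
  set err : ℝ → ℝ := fun r => (A ^ 2 / σ r ^ 2 - A ^ 2 * τ ^ 2) * v r -
    ∫ s in Ioi r, A ^ 2 * deriv σ s / σ s ^ 3 * v s with herr
  have hF : ∀ r, ductForce σ A c q v r = A ^ 2 * τ ^ 2 * (v r - w) + (q (v r) - q w) + err r := by
    intro r
    simp only [ductForce, herr, hc]; ring
  have herr0 : Tendsto err atTop (𝓝 0) := by
    have h1 : Tendsto (fun r => (A ^ 2 / σ r ^ 2 - A ^ 2 * τ ^ 2) * v r) atTop (𝓝 0) := by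
      have h2 := (hσ.tendsto_coeff A).sub_const (A ^ 2 * τ ^ 2)
      rw [sub_self] at h2
      refine h2.zero_mul_isBoundedUnder_le ⟨3 / 2 * vb, ?_⟩
      rw [eventually_map]
      filter_upwards [eventually_ge_atTop a] with r hr using hB r hr
    simpa using h1.sub (tendsto_tail (hσ.integrableOn_kernel_mul A hv.1 hB))
  have key : ∀ η > 0, ∃ R, a < R ∧ ∀ r, R ≤ r → |err r| ≤ ν * η / 4 := by
    intro η hη
    have hpos : |(0 : ℝ)| < ν * η / 4 := by rw [abs_zero]; positivity
    obtain ⟨R, hR⟩ := eventually_atTop.1 (herr0.abs.eventually (ge_mem_nhds hpos))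
    exact ⟨max R (a + 1), lt_max_of_lt_right (by linarith), fun r hr =>
      hR r ((le_max_left _ _).trans hr)⟩
  have hup : ∀ η > 0, ∀ᶠ r in atTop, v r ≤ w + η := by
    intro η hη
    obtain ⟨R, hR, hRe⟩ := key η hη
    refine eventually_le_of_deriv_le_neg (R := R) (c := φ₀ * (ν * η / 4))
      (fun r hr => hd r (hR.trans_le hr)) (by positivity) fun r hr hge => ?_
    have har := hR.trans_le hr
    have h1 := (hq.mem_sub hw (hv.2 r har.le) (by linarith)).1
    have h2 : A ^ 2 * τ ^ 2 * (v r - w) ≤ ν / 32 * (v r - w) :=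
      mul_le_mul_of_nonneg_right hcoef (by linarith)
    have h3 := (abs_le.1 (hRe r hr)).2
    have h4 : ν * η ≤ ν * (v r - w) := mul_le_mul_of_nonneg_left (by linarith) hν.le
    have h5 : ductForce σ A c q v r ≤ -(ν * η / 4) := by
      rw [hF]; linarith [mul_pos hν hη]
    have h6 := mul_le_mul_of_nonneg_right (hφ r har) (by positivity : 0 ≤ ν * η / 4)
    nlinarith [mul_le_mul_of_nonneg_left h5 (hφ₀.le.trans (hφ r har))]
  have hlo : ∀ η > 0, ∀ᶠ r in atTop, -v r ≤ -w + η := by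
    intro η hη
    obtain ⟨R, hR, hRe⟩ := key η hη
    refine eventually_le_of_deriv_le_neg (R := R) (c := φ₀ * (ν * η / 4))
      (fun r hr => (hd r (hR.trans_le hr)).neg) (by positivity) fun r hr hge => ?_
    have har := hR.trans_le hr
    replace hge : -w + η ≤ -v r := hge
    have h1 := (hq.mem_sub (hv.2 r har.le) hw (by linarith)).1
    have h2 : A ^ 2 * τ ^ 2 * (w - v r) ≤ ν / 32 * (w - v r) :=
      mul_le_mul_of_nonneg_right hcoef (by linarith)
    have h3 := (abs_le.1 (hRe r hr)).1
    have h4 : ν * η ≤ ν * (w - v r) := mul_le_mul_of_nonneg_left (by linarith) hν.le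
    have h5 : ν * η / 4 ≤ ductForce σ A c q v r := by
      rw [hF]; linarith [mul_pos hν hη]
    have h6 := mul_le_mul_of_nonneg_right (hφ r har) (by positivity : 0 ≤ ν * η / 4)
    nlinarith [mul_le_mul_of_nonneg_left h5 (hφ₀.le.trans (hφ r har))]
  refine Metric.tendsto_atTop'.2 fun η hη => ?_
  obtain ⟨R, hR⟩ := eventually_atTop.1 ((hup (η / 2) (by positivity)).and
    (hlo (η / 2) (by positivity)))
  refine ⟨R, fun r hr => ?_⟩
  have := hR r hr.le
  rw [Real.dist_eq]
  exact abs_lt.2 ⟨by linarith [this.2], by linarith [this.1]⟩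

/-- Bootstrapping: the pair of `v` and the nonlocal term solves a smooth first order system. -/
theorem contDiffOn_of_ductForce (hσ : IsDuct a τ σ) (hq : ContDiffOn ℝ ∞ q (Ioi 0))
    {φ v : ℝ → ℝ} {B : ℝ} (hφ : ContDiff ℝ ∞ φ) (hv : ContinuousOn v (Ici a))
    (h0 : ∀ r, a ≤ r → 0 < v r) (hB : ∀ r, a ≤ r → |v r| ≤ B)
    (hd : ∀ r, a ≤ r → HasDerivWithinAt v (φ r * ductForce σ A c q v r) (Ici a) r) :
    ContDiffOn ℝ ∞ v (Ici a) := by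
  set N : ℝ → ℝ := fun r => ∫ s in Ioi r, A ^ 2 * deriv σ s / σ s ^ 3 * v s with hN
  have hNd : ∀ r, a ≤ r →
      HasDerivWithinAt N (-(A ^ 2 * deriv σ r / σ r ^ 3 * v r)) (Ici a) r := fun r hr =>
    hasDerivWithinAt_tail ((hσ.continuousOn_kernel A).mul hv)
      (hσ.integrableOn_kernel_mul A hv hB) hr
  have hb : ContDiffOn ℝ ∞ (fun r => A ^ 2 / σ r ^ 2) (Ici a) :=
    contDiffOn_const.div (hσ.smooth.pow 2).contDiffOn fun r hr => pow_ne_zero 2 (hσ.pos r hr).ne'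
  have hk : ContDiffOn ℝ ∞ (fun r => A ^ 2 * deriv σ r / σ r ^ 3) (Ici a) :=
    (contDiffOn_const.mul
      ((contDiff_infty_iff_deriv.1 hσ.smooth).2.contDiffOn)).div
      (hσ.smooth.pow 3).contDiffOn fun r hr => pow_ne_zero 3 (hσ.pos r hr).ne'
  have main : ∀ n : ℕ, ContDiffOn ℝ n v (Ici a) ∧ ContDiffOn ℝ n N (Ici a) := by
    intro n
    induction n with
    | zero =>
      refine ⟨?_, ?_⟩
      · simpa using hv
      · have hNc : ContinuousOn N (Ici a) := fun r hr => (hNd r hr).continuousWithinAt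
        simpa using hNc
    | succ n ih =>
      have hle : (n : WithTop ℕ∞) ≤ ∞ := by exact_mod_cast le_top
      refine ⟨?_, ?_⟩
      · push_cast
        refine (contDiffOn_succ_iff_derivWithin (uniqueDiffOn_Ici a)).2
          ⟨fun r hr => (hd r hr).differentiableWithinAt, by simp, ?_⟩
        have h1 : ContDiffOn ℝ n (fun r => φ r * ductForce σ A c q v r) (Ici a) :=
          (hφ.contDiffOn.of_le hle).mul (((((hb.of_le hle).mul ih.1).add
            ((hq.of_le hle).comp ih.1 fun r hr => h0 r hr)).sub contDiffOn_const).sub ih.2)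
        exact h1.congr fun r hr => (hd r hr).derivWithin (uniqueDiffOn_Ici a r hr)
      · push_cast
        refine (contDiffOn_succ_iff_derivWithin (uniqueDiffOn_Ici a)).2
          ⟨fun r hr => (hNd r hr).differentiableWithinAt, by simp, ?_⟩
        exact (((hk.of_le hle).mul ih.1).neg).congr fun r hr =>
          (hNd r hr).derivWithin (uniqueDiffOn_Ici a r hr)
  exact contDiffOn_infty.2 fun n => (main n).1

end Duct

/-! ### Viscous flow in a duct -/

/-- Smooth viscous flow on `[a, ∞)` in a duct with cross-section `σ`. This covers the radial
Navier–Stokes problem, with `σ(r) = r ^ (n - 1)`, and the boundary layer problem, with `σ = 1` and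
`μ = 1`. -/
structure IsViscousDuctFlow (a μ : ℝ) (σ p : ℝ → ℝ) (ρinf uinf ρm um : ℝ)
    (ρ u : ℝ → ℝ) : Prop extends IsSmoothState a ρ u where
  mass : ∀ r : ℝ, a < r → deriv (fun s => σ s * ρ s * u s) r = 0
  momentum : ∀ r : ℝ, a < r →
    ρ r * u r * deriv u r + deriv (fun s => p (ρ s)) r
      = μ * deriv (fun s => deriv (fun t => σ t * u t) s / σ s) r
  density_far : Tendsto ρ atTop (𝓝 ρinf)
  velocity_far : Tendsto u atTop (𝓝 uinf)
  density_bdry : ρ a = ρm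
  velocity_bdry : u a = um

theorem eq_left_of_deriv_eq_zero {a : ℝ} {f : ℝ → ℝ} (hf : ContinuousOn f (Ici a))
    (hd : ∀ r, a < r → DifferentiableAt ℝ f r) (h0 : ∀ r, a < r → deriv f r = 0) {r : ℝ}
    (hr : a ≤ r) : f r = f a := by
  have hd' : DifferentiableOn ℝ f (interior (Ici a)) := fun x hx =>
    (hd x (by simpa using hx)).differentiableWithinAt
  have h0' : ∀ x ∈ interior (Ici a), deriv f x = 0 := fun x hx => h0 x (by simpa using hx)
  exact le_antisymm
    (antitoneOn_of_deriv_nonpos (convex_Ici a) hf hd' (fun x hx => (h0' x hx).le) self_mem_Ici hr hr)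
    (monotoneOn_of_deriv_nonneg (convex_Ici a) hf hd' (fun x hx => (h0' x hx).ge) self_mem_Ici hr hr)

theorem exists_abs_le_of_tendsto {a w : ℝ} {v : ℝ → ℝ} (hv : ContinuousOn v (Ici a))
    (hw : Tendsto v atTop (𝓝 w)) : ∃ B, ∀ r, a ≤ r → |v r| ≤ B := by
  obtain ⟨R, hR⟩ := eventually_atTop.1 (hw.abs.eventually (ge_mem_nhds (lt_add_one |w|)))
  obtain ⟨C, hC⟩ := isCompact_Icc.exists_bound_of_continuousOn (s := Icc a R)
    (hv.mono fun x hx => hx.1)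
  refine ⟨max C (|w| + 1), fun r hr => ?_⟩
  rcases le_total r R with h | h
  · exact (hC r ⟨hr, h⟩).trans (le_max_left _ _)
  · exact (hR r h).trans (le_max_right _ _)

theorem IsSmoothState.differentiableAt_density {a : ℝ} {ρ u : ℝ → ℝ} (h : IsSmoothState a ρ u)
    {r : ℝ} (hr : a < r) : DifferentiableAt ℝ ρ r :=
  (h.smooth_density.differentiableOn (by simp)).differentiableAt (Ici_mem_nhds hr)

theorem IsSmoothState.differentiableAt_velocity {a : ℝ} {ρ u : ℝ → ℝ} (h : IsSmoothState a ρ u)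
    {r : ℝ} (hr : a < r) : DifferentiableAt ℝ u r :=
  (h.smooth_velocity.differentiableOn (by simp)).differentiableAt (Ici_mem_nhds hr)

section

variable {a τ : ℝ} {σ p : ℝ → ℝ} {A : ℝ}

/-- Conservation of mass determines the velocity from the density. -/
theorem velocity_eq_of_mass (hσ : IsDuct a τ σ) {ρ u : ℝ → ℝ} (h : IsSmoothState a ρ u)
    (hm : ∀ r, a < r → deriv (fun s => σ s * ρ s * u s) r = 0) {r : ℝ} (hr : a ≤ r) :
    u r = σ a * ρ a * u a * (ρ r)⁻¹ / σ r := by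
  have h1 := eq_left_of_deriv_eq_zero (f := fun s => σ s * ρ s * u s)
    ((hσ.smooth.continuous.continuousOn.mul h.smooth_density.continuousOn).mul
      h.smooth_velocity.continuousOn)
    (fun r hr => ((hσ.hasDerivAt r).differentiableAt.mul (h.differentiableAt_density hr)).mul
      (h.differentiableAt_velocity hr)) hm hr
  have h2 := (hσ.pos r hr).ne'
  have h3 := (h.density_pos r hr).ne'
  rw [← h1]
  field_simp

/-- The convective and pressure terms of the momentum equation, in terms of the specific
volume. -/
theorem momentum_eq (hσ : IsDuct a τ σ) {ρ u v : ℝ → ℝ} {v' q' r : ℝ} (hr : a < r)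
    (hρ : ∀ s, a ≤ s → ρ s = (v s)⁻¹) (hu : ∀ s, a ≤ s → u s = A * v s / σ s)
    (hv0 : 0 < v r) (hv : HasDerivAt v v' r) (hq : HasDerivAt (fun x => p x⁻¹) q' (v r)) :
    ρ r * u r * deriv u r + deriv (fun s => p (ρ s)) r =
      (A ^ 2 / σ r ^ 2 + q') * v' - A ^ 2 * deriv σ r / σ r ^ 3 * v r := by
  have hσr := (hσ.pos r hr.le).ne'
  have hev : ∀ᶠ s in 𝓝 r, a ≤ s := Ici_mem_nhds hr
  have h1 : deriv u r = (A * v' * σ r - A * v r * deriv σ r) / σ r ^ 2 := by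
    rw [EventuallyEq.deriv_eq (f := fun s => A * v s / σ s) (hev.mono hu)]
    exact ((hv.const_mul A).div (hσ.hasDerivAt r) hσr).deriv
  have h2 : deriv (fun s => p (ρ s)) r = q' * v' := by
    rw [EventuallyEq.deriv_eq (f := fun s => p (v s)⁻¹) (hev.mono fun s hs => by simp [hρ s hs])]
    exact (hq.comp r hv).deriv
  rw [h1, h2, hρ r hr.le, hu r hr.le]
  field_simp
  ring

theorem tendsto_ductForce (hσ : IsDuct a τ σ) {q v : ℝ → ℝ} {c w : ℝ}
    (hv : ContinuousOn v (Ici a)) (hw : Tendsto v atTop (𝓝 w)) (hq : ContinuousAt q w) :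
    Tendsto (ductForce σ A c q v) atTop (𝓝 (A ^ 2 * τ ^ 2 * w + q w - c)) := by
  obtain ⟨B, hB⟩ := exists_abs_le_of_tendsto hv hw
  have h := ((((hσ.tendsto_coeff A).mul hw).add (hq.tendsto.comp hw)).sub_const c).sub
    (tendsto_tail (hσ.integrableOn_kernel_mul A hv hB))
  rwa [sub_zero] at h

theorem IsPressureLaw.hasDerivAt_inv (hp : IsPressureLaw p) {x : ℝ} (hx : 0 < x) :
    HasDerivAt (fun x => p x⁻¹) (deriv p x⁻¹ * (-(x ^ 2)⁻¹)) x := by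
  have h1 : HasDerivAt p (deriv p x⁻¹) x⁻¹ := ((hp.smooth.differentiableOn
    (by simp)).differentiableAt (Ioi_mem_nhds (inv_pos.2 hx))).hasDerivAt
  exact h1.comp x (_root_.hasDerivAt_inv hx.ne')

/-- The specific volume of a viscous flow solves the first order equation obtained by integrating
the momentum balance from infinity. The integration constant vanishes, since otherwise `v'` would
be bounded away from zero near infinity. -/
theorem IsViscousDuctFlow.hasDerivAt_inv_density (hσ : IsDuct a τ σ) (hp : IsPressureLaw p)
    {μ ρinf uinf ρm um : ℝ} (hρinf : 0 < ρinf) {ρ u : ℝ → ℝ} (hμ : 0 < μ)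
    (h : IsViscousDuctFlow a μ σ p ρinf uinf ρm um ρ u) (hA0 : 0 < A) (hA : A = σ a * ρm * um)
    {r : ℝ} (hr : a < r) :
    HasDerivAt (fun s => (ρ s)⁻¹) (σ r / (μ * A) * ductForce σ A
      (A ^ 2 * τ ^ 2 * ρinf⁻¹ + p ρinf⁻¹⁻¹) (fun x => p x⁻¹) (fun s => (ρ s)⁻¹) r) r := by
  set v : ℝ → ℝ := fun s => (ρ s)⁻¹ with hv
  set q : ℝ → ℝ := fun x => p x⁻¹ with hq
  set c := A ^ 2 * τ ^ 2 * ρinf⁻¹ + p ρinf⁻¹⁻¹ with hc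
  have hv0 : ∀ s, a ≤ s → 0 < v s := fun s hs => inv_pos.2 (h.density_pos s hs)
  have hvsm : ContDiffOn ℝ ∞ v (Ici a) :=
    h.smooth_density.inv fun s hs => (h.density_pos s hs).ne'
  have hvlim : Tendsto v atTop (𝓝 ρinf⁻¹) := h.density_far.inv₀ hρinf.ne'
  obtain ⟨B, hB⟩ := exists_abs_le_of_tendsto hvsm.continuousOn hvlim
  have hu : ∀ s, a ≤ s → u s = A * v s / σ s := fun s hs => by
    rw [velocity_eq_of_mass hσ h.toIsSmoothState h.mass hs, h.density_bdry, h.velocity_bdry, hA]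
  have hvd : ∀ s, a < s → HasDerivAt v (deriv v s) s := fun s hs =>
    ((hvsm.differentiableOn (by simp)).differentiableAt (Ici_mem_nhds hs)).hasDerivAt
  have hvdd : DifferentiableOn ℝ (deriv v) (Ioi a) :=
    ((contDiffOn_infty_iff_deriv_of_isOpen isOpen_Ioi).1
      (hvsm.mono Ioi_subset_Ici_self)).2.differentiableOn (by simp)
  set ψ : ℝ → ℝ := fun s => μ * (A * deriv v s / σ s) with hψ
  have hψ1 : ∀ s, a < s →
      (fun s => deriv (fun t => σ t * u t) s / σ s) =ᶠ[𝓝 s] fun s => A * deriv v s / σ s := by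
    intro s hs
    filter_upwards [Ioi_mem_nhds hs] with x hx
    rw [EventuallyEq.deriv_eq (f := fun t => A * v t)]
    · rw [((hvd x hx).const_mul A).deriv]
    · filter_upwards [Ici_mem_nhds hx] with t ht
      have := (hσ.pos t ht).ne'
      rw [hu t ht]
      field_simp
  have hψd : ∀ s, a < s → DifferentiableAt ℝ ψ s := fun s hs =>
    (((hvdd.differentiableAt (Ioi_mem_nhds hs)).const_mul A).div
      (hσ.hasDerivAt s).differentiableAt (hσ.pos s hs.le).ne').const_mul μ
  have hFd := fun s (hs : a < s) => hasDerivAt_ductForce (A := A) (c := c) (q := q) hσ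
    hvsm.continuousOn hB hs (hvd s hs) (hp.hasDerivAt_inv (hv0 s hs.le))
  have hψ' : ∀ s, a < s → deriv (fun s => ψ s - ductForce σ A c q v s) s = 0 := by
    intro s hs
    rw [deriv_fun_sub (hψd s hs) (hFd s hs).differentiableAt, (hFd s hs).deriv, sub_eq_zero]
    rw [← momentum_eq hσ hs (p := p) (ρ := ρ) (u := u) (fun t _ => by simp [hv]) hu
      (hv0 s hs.le) (hvd s hs) (hp.hasDerivAt_inv (hv0 s hs.le)), h.momentum s hs,
      (hψ1 s hs).deriv_eq, ← deriv_const_mul_field μ]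
  obtain ⟨L, hL⟩ := isOpen_Ioi.exists_is_const_of_deriv_eq_zero isPreconnected_Ioi
    (fun s hs => ((hψd s hs).sub (hFd s hs).differentiableAt).differentiableWithinAt) hψ'
  have hψlim : Tendsto ψ atTop (𝓝 L) := by
    have h1 := (tendsto_ductForce (A := A) (c := c) hσ hvsm.continuousOn hvlim
      (hp.hasDerivAt_inv (inv_pos.2 hρinf)).continuousAt).const_add L
    have h2 : L + (A ^ 2 * τ ^ 2 * ρinf⁻¹ + p ρinf⁻¹⁻¹ - c) = L := by simp [hc]
    rw [h2] at h1
    refine h1.congr' ?_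
    filter_upwards [eventually_gt_atTop a] with s hs
    have h3 : ψ s - ductForce σ A c q v s = L := hL s hs
    linarith
  have hvψ : ∀ s, a < s → deriv v s = σ s / (μ * A) * ψ s := fun s hs => by
    have := (hσ.pos s hs.le).ne'
    simp only [hψ]
    field_simp
  have hpos : 0 < σ a / (μ * A) := div_pos (hσ.pos a le_rfl) (mul_pos hμ hA0)
  have hrate : ∀ s, a < s → σ a / (μ * A) ≤ σ s / (μ * A) := fun s hs =>
    div_le_div_of_nonneg_right (hσ.le_apply hs.le) (mul_pos hμ hA0).le
  have hL0 : L = 0 := by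
    rcases lt_trichotomy L 0 with hneg | h0 | hpos'
    · exfalso
      obtain ⟨R, hR⟩ := eventually_atTop.1 ((hψlim.eventually
        (ge_mem_nhds (show L < L / 2 by linarith))).and (eventually_gt_atTop a))
      refine not_tendsto_of_le_deriv (R := R) (f := fun s => -v s) (f' := fun s => -deriv v s)
        (c := σ a / (μ * A) * (-(L / 2)))
        (fun s hs => (hvd s (hR s hs).2).neg) (by nlinarith) (fun s hs => ?_) hvlim.neg
      rw [hvψ s (hR s hs).2]
      have h1 := (hR s hs).1
      nlinarith [hrate s (hR s hs).2]
    · exact h0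
    · exfalso
      obtain ⟨R, hR⟩ := eventually_atTop.1 ((hψlim.eventually
        (le_mem_nhds (show L / 2 < L by linarith))).and (eventually_gt_atTop a))
      refine not_tendsto_of_le_deriv (R := R) (f := v) (f' := deriv v)
        (c := σ a / (μ * A) * (L / 2))
        (fun s hs => hvd s (hR s hs).2) (by nlinarith) (fun s hs => ?_) hvlim
      rw [hvψ s (hR s hs).2]
      have h1 := (hR s hs).1
      nlinarith [hrate s (hR s hs).2]
  have h1 := hvd r hr
  rw [hvψ r hr] at h1
  have h2 : ψ r - ductForce σ A c q v r = 0 := (hL r hr).trans hL0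
  rwa [sub_eq_zero.1 h2] at h1

/-- A smooth solution of the integrated equation yields a viscous flow. -/
theorem isViscousDuctFlow_of_hasDerivWithinAt (hσ : IsDuct a τ σ) (hp : IsPressureLaw p)
    {μ c w B : ℝ} (hw : 0 < w) {v : ℝ → ℝ} (hμ : 0 < μ) (hA0 : 0 < A)
    (hv : ContDiffOn ℝ ∞ v (Ici a)) (hv0 : ∀ r, a ≤ r → 0 < v r) (hB : ∀ r, a ≤ r → |v r| ≤ B)
    (hlim : Tendsto v atTop (𝓝 w))
    (hd : ∀ r, a < r →
      HasDerivAt v (σ r / (μ * A) * ductForce σ A c (fun x => p x⁻¹) v r) r) :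
    IsViscousDuctFlow a μ σ p w⁻¹ (A * τ * w) (v a)⁻¹ (A * v a / σ a)
      (fun r => (v r)⁻¹) (fun r => A * v r / σ r) where
  smooth_density := hv.inv fun r hr => (hv0 r hr).ne'
  smooth_velocity := (contDiffOn_const.mul hv).div hσ.smooth.contDiffOn
    fun r hr => (hσ.pos r hr).ne'
  density_pos r hr := inv_pos.2 (hv0 r hr)
  mass r hr := by
    rw [EventuallyEq.deriv_eq (f := fun _ => A)]
    · simp
    · filter_upwards [Ici_mem_nhds hr] with s hs
      have := (hσ.pos s hs).ne'
      have := (hv0 s hs).ne'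
      field_simp
  momentum r hr := by
    rw [momentum_eq (p := p) (A := A) (v := v) hσ hr (fun s _ => rfl) (fun s _ => rfl)
      (hv0 r hr.le) (hd r hr) (hp.hasDerivAt_inv (hv0 r hr.le)),
      ← (hasDerivAt_ductForce (A := A) (c := c) hσ hv.continuousOn hB hr (hd r hr)
        (hp.hasDerivAt_inv (hv0 r hr.le))).deriv, ← deriv_const_mul_field μ]
    refine (EventuallyEq.deriv_eq ?_).symm
    filter_upwards [Ioi_mem_nhds hr] with s hs
    rw [EventuallyEq.deriv_eq (f := fun t => A * v t)]
    · rw [((hd s hs).const_mul A).deriv]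
      have := (hσ.pos s (le_of_lt hs)).ne'
      field_simp
    · filter_upwards [Ici_mem_nhds hs] with t ht
      have := (hσ.pos t ht).ne'
      field_simp
  density_far := hlim.inv₀ hw.ne'
  velocity_far := by
    have := (hσ.lim.const_mul A).mul hlim
    refine this.congr fun r => ?_
    ring
  density_bdry := rfl
  velocity_bdry := rfl

/-- Well-posedness of viscous flow in a duct, in terms of the specific volume. -/
theorem exists_isTheUniquePair_viscousDuctFlow (hσ : IsDuct a τ σ) (hp : IsPressureLaw p)
    {vb δ ν K M μ w v₀ : ℝ} (hq : IsPressureWindow (fun x => p x⁻¹) vb δ ν K M)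
    (hs : A ^ 2 / σ a ^ 2 * vb ≤ ν * δ / 16) (hw : |w - vb| ≤ δ)
    (hc : |p vb⁻¹ - (A ^ 2 * τ ^ 2 * w + p w⁻¹)| ≤ ν * δ / 8) (hμ : 0 < μ) (hA0 : 0 < A)
    (hv₀ : |v₀ - vb| < δ) :
    ∃ v ∈ tube a vb δ, v a = v₀ ∧
      (∀ r, a < r → HasDerivAt v (σ r / (μ * A) *
        ductForce σ A (A ^ 2 * τ ^ 2 * w + p w⁻¹) (fun x => p x⁻¹) v r) r) ∧
      IsTheUniquePair a
        (IsViscousDuctFlow a μ σ p w⁻¹ (A * τ * w) v₀⁻¹ (A * v₀ / σ a))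
        (fun r => (v r)⁻¹) (fun r => A * v r / σ r) := by
  have hμA := mul_pos hμ hA0
  have hF := isDamped_ductForce hσ hq hs hc
  have hφ : ∀ r, a ≤ r → 0 < σ r / (μ * A) := fun r hr => div_pos (hσ.pos r hr) hμA
  have hφs : ContDiff ℝ ∞ fun r => σ r / (μ * A) := hσ.smooth.div_const _
  obtain ⟨v, hv, hva, hvd⟩ := hF.exists_solution hφs.continuous.continuousOn hφ hv₀.le
  have hvd' : ∀ r, a < r → HasDerivAt v (σ r / (μ * A) *
      ductForce σ A (A ^ 2 * τ ^ 2 * w + p w⁻¹) (fun x => p x⁻¹) v r) r := fun r hr =>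
    (hvd r hr.le).hasDerivAt (Ici_mem_nhds hr)
  have hv0 : ∀ r, a ≤ r → 0 < v r := fun r hr => hq.pos (hv.2 r hr)
  have hB := hq.abs_le_of_mem_tube hv
  have hlim : Tendsto v atTop (𝓝 w) := tendsto_of_ductForce hσ hq hs hw rfl
    (div_pos (hσ.pos a le_rfl) hμA)
    (fun r hr => div_le_div_of_nonneg_right (hσ.le_apply hr.le) hμA.le) hv hvd'
  have hsm := contDiffOn_of_ductForce hσ hq.smooth hφs hv.1 hv0 hB hvd
  have hw0 := hq.pos hw
  have hflow := isViscousDuctFlow_of_hasDerivWithinAt hσ hp hw0 hμ hA0 hsm hv0 hB hlim hvd'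
  rw [hva] at hflow
  refine ⟨v, hv, hva, hvd', hflow, fun ρ₁ u₁ h₁ => ?_⟩
  have hv₀0 : 0 < v₀ := hq.pos hv₀.le
  have hσa := (hσ.pos a le_rfl).ne'
  have hA : A = σ a * v₀⁻¹ * (A * v₀ / σ a) := by field_simp
  have hd₁ := fun r (hr : a < r) =>
    h₁.hasDerivAt_inv_density hσ hp (inv_pos.2 hw0) hμ hA0 hA hr
  simp only [inv_inv] at hd₁
  have hc₁ : ContinuousOn (fun r => (ρ₁ r)⁻¹) (Ici a) :=
    h₁.smooth_density.continuousOn.inv₀ fun r hr => (h₁.density_pos r hr).ne'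
  have ha₁ : (ρ₁ a)⁻¹ = v₀ := by rw [h₁.density_bdry, inv_inv]
  have ht₁ := mem_tube_of_ductForce hσ hq hs hc (fun r hr => hφ r hr.le) hc₁
    (fun r hr => inv_pos.2 (h₁.density_pos r hr)) hd₁ (by rw [ha₁]; exact hv₀)
  have heq : ∀ r, a ≤ r → ρ₁ r = (v r)⁻¹ := by
    intro r hr
    have := hF.abs_sub_le (E := fun _ => 0) (e := 0) (fun r hr => hφ r hr.le) ht₁ hv
      (by rw [ha₁, hva]) hd₁ (fun r hr => by simpa using hvd' r hr) (by simp) r hr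
    rw [zero_div] at this
    rw [← sub_eq_zero.1 (abs_nonpos_iff.1 this), inv_inv]
  refine ⟨heq, fun r hr => ?_⟩
  rw [velocity_eq_of_mass hσ h₁.toIsSmoothState h₁.mass hr, h₁.density_bdry, h₁.velocity_bdry,
    ← hA, heq r hr, inv_inv]

end

/-! ### Pressure windows and the subsonic Bernoulli branch -/

section

variable {p : ℝ → ℝ}

theorem IsPressureLaw.exists_isPressureWindow (hp : IsPressureLaw p) {vb : ℝ} (hvb : 0 < vb) :
    ∃ δ ν K M, IsPressureWindow (fun x => p x⁻¹) vb δ ν K M := by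
  set q : ℝ → ℝ := fun x => p x⁻¹ with hq
  have hqs : ContDiffOn ℝ ∞ q (Ioi 0) :=
    hp.smooth.comp (contDiffOn_inv ℝ |>.mono fun x hx => ne_of_gt hx) fun x hx => mem_Ioi.2 (inv_pos.2 hx)
  have hq's : ContDiffOn ℝ ∞ (deriv q) (Ioi 0) :=
    ((contDiffOn_infty_iff_deriv_of_isOpen isOpen_Ioi).1 hqs).2
  have hnhds := Ioi_mem_nhds hvb
  have hat : ContDiffAt ℝ ∞ (deriv q) vb := hq's.contDiffAt hnhds
  have hneg : deriv q vb < 0 := by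
    rw [(hp.hasDerivAt_inv hvb).deriv]
    have := mul_pos (hp.deriv_pos _ (inv_pos.2 hvb)) (inv_pos.2 (pow_pos hvb 2))
    linarith
  obtain ⟨M, t, ht, hM⟩ := (hat.of_le (m := 1) (by exact_mod_cast le_top)).exists_lipschitzOnWith
  have hev : ∀ᶠ x in 𝓝 vb, deriv q x ∈ Icc (2 * deriv q vb) (deriv q vb / 2) :=
    hat.continuousAt.eventually (Icc_mem_nhds (by linarith) (by linarith))
  obtain ⟨r, hr, hball⟩ := Metric.eventually_nhds_iff_ball.1 (hev.and ht)
  refine ⟨min (r / 2) (vb / 2), -(deriv q vb / 2), -(2 * deriv q vb), M,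
    lt_min (by linarith) (by linarith), min_le_right _ _, by linarith, by linarith, hqs, ?_, ?_⟩
  · intro x hx
    have hx' : x ∈ Metric.ball vb r := by
      rw [Metric.mem_ball, Real.dist_eq]
      linarith [hx.trans (min_le_left _ _)]
    simpa using (hball x hx').1
  · intro x y hx hy
    have hx' : x ∈ Metric.ball vb r := by
      rw [Metric.mem_ball, Real.dist_eq]
      linarith [hx.trans (min_le_left _ _)]
    have hy' : y ∈ Metric.ball vb r := by
      rw [Metric.mem_ball, Real.dist_eq]
      linarith [hy.trans (min_le_left _ _)]
    simpa [Real.dist_eq] using hM.dist_le_mul x (hball x hx').2 y (hball y hy').2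

/-- The enthalpy `h`, normalized by `h(ρ₊) = 0`, together with the smooth subsonic branch `g` of
solutions `ρ = g(s)` of Bernoulli's equation `h(ρ) + s / (2 ρ ^ 2) = 0` with `g(0) = ρ₊`, where `s`
stands for the squared momentum. -/
structure IsBernoulliBranch (p : ℝ → ℝ) (ρp : ℝ) (h g : ℝ → ℝ) (s₀ L : ℝ) : Prop where
  radius_pos : 0 < s₀
  const_pos : 0 < L
  hasDerivAt : ∀ ρ, 0 < ρ → HasDerivAt h (deriv p ρ / ρ) ρ
  apply_far : h ρp = 0
  smooth : ContDiffOn ℝ ∞ g (Ioo (-s₀) s₀)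
  pos : ∀ s ∈ Ioo (-s₀) s₀, 0 < g s
  abs_sub_le : ∀ s ∈ Ioo (-s₀) s₀, |g s - ρp| ≤ L * |s|
  bernoulli : ∀ s ∈ Ioo (-s₀) s₀, h (g s) + s / 2 * (g s)⁻¹ ^ 2 = 0
  unique : ∀ ρ s, |ρ - ρp| ≤ L * s₀ → s ∈ Ioo (-s₀) s₀ → 0 < ρ →
    h ρ + s / 2 * ρ⁻¹ ^ 2 = 0 → ρ = g s

/-- The branch is the local inverse at `ρ₊` of `ρ ↦ -2 ρ ^ 2 h(ρ)`, whose derivative there is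
`-2 ρ₊ p'(ρ₊) ≠ 0`. -/
theorem IsPressureLaw.exists_isBernoulliBranch (hp : IsPressureLaw p) {ρp : ℝ} (hρp : 0 < ρp) :
    ∃ h g s₀ L, IsBernoulliBranch p ρp h g s₀ L := by
  have hp's : ContDiffOn ℝ ∞ (deriv p) (Ioi 0) :=
    ((contDiffOn_infty_iff_deriv_of_isOpen isOpen_Ioi).1 hp.smooth).2
  have hk : ContDiffOn ℝ ∞ (fun t => deriv p t / t) (Ioi 0) :=
    hp's.div contDiffOn_id fun x hx => ne_of_gt hx
  set h : ℝ → ℝ := fun ρ => ∫ t in ρp..ρ, deriv p t / t with hh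
  have hd : ∀ ρ, 0 < ρ → HasDerivAt h (deriv p ρ / ρ) ρ := by
    intro ρ hρ
    refine intervalIntegral.integral_hasDerivAt_right ?_
      (hk.continuousOn.stronglyMeasurableAtFilter isOpen_Ioi ρ hρ)
      (hk.continuousOn.continuousAt (Ioi_mem_nhds hρ))
    refine (hk.continuousOn.mono fun x hx => ?_).intervalIntegrable
    exact (lt_min hρp hρ).trans_le hx.1
  have hsm : ContDiffOn ℝ ∞ h (Ioi 0) :=
    (contDiffOn_infty_iff_deriv_of_isOpen isOpen_Ioi).2
      ⟨fun x hx => (hd x hx).differentiableAt.differentiableWithinAt,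
        hk.congr fun x hx => (hd x hx).deriv⟩
  have h0 : h ρp = 0 := by simp [hh]
  set S : ℝ → ℝ := fun ρ => -2 * ρ ^ 2 * h ρ with hS
  have hSs : ContDiffOn ℝ ∞ S (Ioi 0) :=
    ((contDiff_const.mul (contDiff_id.pow 2)).contDiffOn).mul hsm
  have hSat : ∀ ρ, 0 < ρ → ContDiffAt ℝ ∞ S ρ := fun ρ hρ => hSs.contDiffAt (Ioi_mem_nhds hρ)
  have hS0 : S ρp = 0 := by simp [hS, h0]
  have hSd : deriv S ρp ≠ 0 := by
    have h1 : HasDerivAt S (-2 * (2 * ρp) * h ρp + -2 * ρp ^ 2 * (deriv p ρp / ρp)) ρp := by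
      convert! (((hasDerivAt_pow 2 ρp).const_mul (-2)).mul (hd ρp hρp)) using 1
      simp
    rw [h1.deriv, h0]
    have h2 := mul_pos (pow_pos hρp 2) (div_pos (hp.deriv_pos ρp hρp) hρp)
    linarith
  have hSs1 : ContDiffOn ℝ ∞ (deriv S) (Ioi 0) :=
    ((contDiffOn_infty_iff_deriv_of_isOpen isOpen_Ioi).1 hSs).2
  have hstrict : HasStrictDerivAt S (deriv S ρp) ρp := (hSat ρp hρp).hasStrictDerivAt (by simp)
  let e := (hstrict.hasStrictFDerivAt_equiv hSd).toOpenPartialHomeomorph S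
  have heS : ∀ x, e x = S x := fun x => rfl
  have hsrc : ρp ∈ e.source :=
    (hstrict.hasStrictFDerivAt_equiv hSd).mem_toOpenPartialHomeomorph_source
  have htgt : (0 : ℝ) ∈ e.target := by
    rw [← hS0]; exact e.map_source hsrc
  have hg0 : e.symm 0 = ρp := by rw [← hS0, ← heS, e.left_inv hsrc]
  have hgc : ContinuousAt e.symm 0 := e.continuousAt_symm htgt
  have hev : ∀ᶠ s in 𝓝 (0 : ℝ), s ∈ e.target ∧ 0 < e.symm s ∧ deriv S (e.symm s) ≠ 0 := by
    have ht0 : ∀ᶠ s in 𝓝 (0 : ℝ), s ∈ e.target := e.open_target.mem_nhds htgt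
    refine ht0.and ?_
    have h1 : ∀ᶠ ρ in 𝓝 ρp, 0 < ρ ∧ deriv S ρ ≠ 0 :=
      (eventually_gt_nhds hρp).and ((hSs1.continuousOn.continuousAt (Ioi_mem_nhds hρp)).eventually_ne hSd)
    rw [← hg0] at h1
    exact hgc.eventually h1
  have hgat : ∀ s, s ∈ e.target ∧ 0 < e.symm s ∧ deriv S (e.symm s) ≠ 0 →
      ContDiffAt ℝ ∞ e.symm s := fun s hs =>
    e.contDiffAt_symm_deriv hs.2.2 hs.1
      ((hSat _ hs.2.1).differentiableAt (by simp)).hasDerivAt (hSat _ hs.2.1)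
  obtain ⟨L, t, ht, hL⟩ := ((hgat 0 hev.self_of_nhds).of_le (m := 1)
    (by exact_mod_cast le_top)).exists_lipschitzOnWith
  obtain ⟨s₁, hs₁, hball⟩ := Metric.eventually_nhds_iff_ball.1 (hev.and ht)
  obtain ⟨η, hη, hηs⟩ := Metric.nhds_basis_closedBall.mem_iff.1 (e.open_source.mem_nhds hsrc)
  set L' : ℝ := L + 1 with hL'
  have hLpos : 0 < L' := by positivity
  set s₀ := min s₁ (η / L') with hs₀
  have hs₀pos : 0 < s₀ := lt_min hs₁ (div_pos hη hLpos)
  have hmem : ∀ s ∈ Ioo (-s₀) s₀, s ∈ Metric.ball (0 : ℝ) s₁ := fun s hs => by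
    rw [Metric.mem_ball, Real.dist_eq, sub_zero]
    exact (abs_lt.2 hs).trans_le (min_le_left _ _)
  refine ⟨h, e.symm, s₀, L', hs₀pos, hLpos, hd, h0, fun s hs =>
    (hgat s (hball s (hmem s hs)).1).contDiffWithinAt, fun s hs => (hball s (hmem s hs)).1.2.1,
    fun s hs => ?_, fun s hs => ?_, fun ρ s hρs hs hρ0 hb => ?_⟩
  · have h1 := hL.dist_le_mul s (hball s (hmem s hs)).2 0 (mem_of_mem_nhds ht)
    rw [Real.dist_eq, Real.dist_eq, hg0, sub_zero] at h1
    exact h1.trans (mul_le_mul_of_nonneg_right (by linarith) (abs_nonneg s))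
  · have h1 := e.right_inv (hball s (hmem s hs)).1.1
    have h2 := (hball s (hmem s hs)).1.2.1
    rw [heS] at h1
    have h3 : s = -2 * e.symm s ^ 2 * h (e.symm s) := h1.symm
    have h4 : s / 2 * (e.symm s)⁻¹ ^ 2 = -2 * e.symm s ^ 2 * h (e.symm s) / 2 *
        (e.symm s)⁻¹ ^ 2 := by rw [← h3]
    rw [h4]
    field_simp
    ring
  · have h1 : ρ ∈ e.source := hηs (by
      rw [Metric.mem_closedBall, Real.dist_eq]
      refine hρs.trans ?_
      rw [mul_comm, ← le_div_iff₀ hLpos]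
      exact min_le_right _ _)
    have h2 : s = S ρ := by
      simp only [hS]
      field_simp at hb
      linarith
    rw [h2, ← heS, e.left_inv h1]

end

/-! ### The Euler problem -/

theorem isDuct_pow {n : ℕ} (hn : 2 ≤ n) {r₀ : ℝ} (hr₀ : 0 < r₀) :
    IsDuct r₀ 0 (fun r => r ^ (n - 1)) where
  smooth := contDiff_id.pow _
  pos r hr := pow_pos (hr₀.trans_le hr) _
  mono r hr := by
    have := hr₀.trans_le hr
    simp only [deriv_pow_field]
    positivity
  lim := (tendsto_pow_atTop (by omega)).inv_tendsto_atTop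

section

variable {a : ℝ} {p : ℝ → ℝ} {A : ℝ}

/-- Bernoulli's law: the derivative of `h(ρ) + (A / σ) ^ 2 / (2 ρ ^ 2)` is the momentum balance
divided by the density. -/
theorem hasDerivAt_bernoulli {τ : ℝ} {σ : ℝ → ℝ} (hσ : IsDuct a τ σ) {h v : ℝ → ℝ} {v' r : ℝ}
    (hh : ∀ ρ, 0 < ρ → HasDerivAt h (deriv p ρ / ρ) ρ)
    (hr : a < r) (hv0 : 0 < v r) (hv : HasDerivAt v v' r) :
    HasDerivAt (fun s => h (v s)⁻¹ + A ^ 2 / σ s ^ 2 / 2 * v s ^ 2)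
      (v r * ((A ^ 2 / σ r ^ 2 + deriv p (v r)⁻¹ * (-(v r ^ 2)⁻¹)) * v' -
        A ^ 2 * deriv σ r / σ r ^ 3 * v r)) r := by
  have hσr := (hσ.pos r hr.le).ne'
  have h1 := (hh _ (inv_pos.2 hv0)).comp r (hv.inv hv0.ne')
  have h2 := ((hσ.hasDerivAt_coeff A hr.le).div_const 2).mul (hv.pow 2)
  convert! h1.add h2 using 1
  field_simp
  simp
  ring

variable {n : ℕ} {ρp m s₀ L : ℝ} {h g : ℝ → ℝ}

/-- The density of an Euler solution lies on the Bernoulli branch: it does so near infinity, and it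
cannot leave a neighbourhood of `ρ₊` in which the branch is the only root. -/
theorem IsEulerSolution.density_eq (hn : 2 ≤ n) (ha : 0 < a) (hp : IsPressureLaw p)
    (hρp : 0 < ρp) (hg : IsBernoulliBranch p ρp h g s₀ L) (hm : m ^ 2 < s₀) {ρ u : ℝ → ℝ}
    (hE : IsEulerSolution n a p ρp 0 m ρ u) :
    ∀ r, a ≤ r → ρ r = g ((a ^ (n - 1) * m) ^ 2 / (r ^ (n - 1)) ^ 2) := by
  have hσ := isDuct_pow hn ha
  set A := a ^ (n - 1) * m with hA
  set v : ℝ → ℝ := fun s => (ρ s)⁻¹ with hv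
  have hv0 : ∀ s, a ≤ s → 0 < v s := fun s hs => inv_pos.2 (hE.density_pos s hs)
  have hvc : ContinuousOn v (Ici a) :=
    hE.smooth_density.continuousOn.inv₀ fun s hs => (hE.density_pos s hs).ne'
  have hvd : ∀ s, a < s → HasDerivAt v (deriv v s) s := fun s hs =>
    ((hE.differentiableAt_density hs).inv (hE.density_pos s hs.le).ne').hasDerivAt
  have hu : ∀ s, a ≤ s → u s = A * v s / s ^ (n - 1) := fun s hs => by
    rw [velocity_eq_of_mass hσ hE.toIsSmoothState hE.mass hs, mul_assoc (a ^ (n - 1)),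
      hE.flux_bdry]
  have hbd := fun s (hs : a < s) => hasDerivAt_bernoulli (A := A) (h := h) hσ hg.hasDerivAt hs
    (hv0 s hs.le) (hvd s hs)
  have hbd0 : ∀ s, a < s →
      deriv (fun s => h (v s)⁻¹ + A ^ 2 / (s ^ (n - 1)) ^ 2 / 2 * v s ^ 2) s = 0 := by
    intro s hs
    rw [(hbd s hs).deriv, ← momentum_eq (A := A) (p := p) (ρ := ρ) (u := u) hσ hs
      (fun t _ => by simp [hv]) hu (hv0 s hs.le) (hvd s hs) (hp.hasDerivAt_inv (hv0 s hs.le)),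
      hE.momentum s hs, mul_zero]
  obtain ⟨C, hC⟩ := isOpen_Ioi.exists_is_const_of_deriv_eq_zero isPreconnected_Ioi
    (fun s hs => (hbd s hs).differentiableAt.differentiableWithinAt) hbd0
  have hlim : Tendsto (fun s => h (v s)⁻¹ + A ^ 2 / (s ^ (n - 1)) ^ 2 / 2 * v s ^ 2) atTop
      (𝓝 0) := by
    have h1 : Tendsto (fun s => h (v s)⁻¹) atTop (𝓝 0) := by
      rw [← hg.apply_far]
      refine ((hg.hasDerivAt ρp hρp).continuousAt.tendsto.comp hE.density_far).congr fun s => ?_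
      simp [hv]
    have h2 := ((hσ.tendsto_coeff A).div_const 2).mul ((hE.density_far.inv₀ hρp.ne').pow 2)
    simpa [hv] using h1.add h2
  have hC0 : C = 0 := by
    refine tendsto_nhds_unique (tendsto_const_nhds.congr' ?_) hlim
    filter_upwards [eventually_gt_atTop a] with s hs
    exact (hC s hs).symm
  have hs : ∀ r, a ≤ r → A ^ 2 / (r ^ (n - 1)) ^ 2 ∈ Ioo (-s₀) s₀ := by
    intro r hr
    have h1 := hσ.coeff_le A hr
    have h2 : A ^ 2 / (a ^ (n - 1)) ^ 2 = m ^ 2 := by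
      have := (hσ.pos a le_rfl).ne'
      rw [hA, mul_pow]
      field_simp
    have h3 := hσ.coeff_nonneg A r
    exact ⟨by linarith [hg.radius_pos], by linarith⟩
  have hroot : ∀ r, a < r → |ρ r - ρp| ≤ L * s₀ → ρ r = g (A ^ 2 / (r ^ (n - 1)) ^ 2) := by
    intro r hr hle
    refine hg.unique _ _ hle (hs r hr.le) (hE.density_pos r hr.le) ?_
    have := (hC r hr).trans hC0
    simpa [hv] using this
  have hLs : 0 < L * s₀ := mul_pos hg.const_pos hg.radius_pos
  have hclose : ∀ r, a < r → |ρ r - ρp| ≤ L * s₀ := by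
    intro r hr
    by_contra! hgt
    have hlim' : Tendsto (fun s => |ρ s - ρp|) atTop (𝓝 0) := by
      simpa using (hE.density_far.sub_const ρp).abs
    obtain ⟨R, hR, hrR⟩ := ((hlim'.eventually (ge_mem_nhds hLs)).and
      (eventually_ge_atTop r)).exists
    have hc : ContinuousOn (fun s => |ρ s - ρp|) (Icc r R) :=
      ((hE.smooth_density.continuousOn.mono fun x hx => hr.le.trans hx.1).sub
        continuousOn_const).abs
    obtain ⟨x, hx, hxe⟩ := intermediate_value_Icc' hrR hc ⟨hR, hgt.le⟩
    simp only at hxe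
    have hax := hr.trans_le hx.1
    have h1 := hroot x hax hxe.le
    have h2 := hg.abs_sub_le _ (hs x hax.le)
    rw [← h1, hxe] at h2
    exact absurd (le_of_mul_le_mul_left h2 hg.const_pos) (not_le.2 (abs_lt.2 (hs x hax.le)))
  -- The endpoint `a` is reached by continuity.
  have heq : EqOn ρ (fun r => g (A ^ 2 / (r ^ (n - 1)) ^ 2)) (Ioi a) := fun r hr =>
    hroot r hr (hclose r hr)
  intro r hr
  have hgc : ContinuousOn (fun r => g (A ^ 2 / (r ^ (n - 1)) ^ 2)) (Ici a) :=
    hg.smooth.continuousOn.comp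
      (fun r hr => (hσ.hasDerivAt_coeff A hr).continuousAt.continuousWithinAt) hs
  refine heq.of_subset_closure hE.smooth_density.continuousOn hgc Ioi_subset_Ici_self ?_ hr
  rw [closure_Ioi]

/-- The state on the Bernoulli branch solves the Euler problem. -/
theorem IsBernoulliBranch.isEulerSolution (hn : 2 ≤ n) (ha : 0 < a) (hp : IsPressureLaw p)
    (hg : IsBernoulliBranch p ρp h g s₀ L) (hm : m ^ 2 < s₀) :
    IsEulerSolution n a p ρp 0 m (fun r => g ((a ^ (n - 1) * m) ^ 2 / (r ^ (n - 1)) ^ 2))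
      (fun r => a ^ (n - 1) * m * (g ((a ^ (n - 1) * m) ^ 2 / (r ^ (n - 1)) ^ 2))⁻¹ /
        r ^ (n - 1)) := by
  have hσ := isDuct_pow hn ha
  set A := a ^ (n - 1) * m with hA
  have hs : ∀ r, a ≤ r → A ^ 2 / (r ^ (n - 1)) ^ 2 ∈ Ioo (-s₀) s₀ := by
    intro r hr
    have h1 := hσ.coeff_le A hr
    have h2 : A ^ 2 / (a ^ (n - 1)) ^ 2 = m ^ 2 := by
      have := (hσ.pos a le_rfl).ne'
      rw [hA, mul_pow]
      field_simp
    have h3 := hσ.coeff_nonneg A r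
    exact ⟨by linarith [hg.radius_pos], by linarith⟩
  set ρ : ℝ → ℝ := fun r => g (A ^ 2 / (r ^ (n - 1)) ^ 2) with hρ
  have hbs : ContDiffOn ℝ ∞ (fun r : ℝ => A ^ 2 / (r ^ (n - 1)) ^ 2) (Ici a) :=
    contDiffOn_const.div (hσ.smooth.pow 2).contDiffOn fun r hr => pow_ne_zero 2 (hσ.pos r hr).ne'
  have hρs : ContDiffOn ℝ ∞ ρ (Ici a) := hg.smooth.comp hbs hs
  have hρ0 : ∀ r, a ≤ r → 0 < ρ r := fun r hr => hg.pos _ (hs r hr)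
  have hvs : ContDiffOn ℝ ∞ (fun r => (ρ r)⁻¹) (Ici a) := hρs.inv fun r hr => (hρ0 r hr).ne'
  have h0mem : (0 : ℝ) ∈ Ioo (-s₀) s₀ := ⟨by linarith [hg.radius_pos], hg.radius_pos⟩
  have hg0 : g 0 = ρp := by
    have := hg.abs_sub_le 0 h0mem
    rw [abs_zero, mul_zero] at this
    exact sub_eq_zero.1 (abs_nonpos_iff.1 this)
  have hρlim : Tendsto ρ atTop (𝓝 ρp) := by
    have h1 := hσ.tendsto_coeff A
    rw [zero_pow two_ne_zero, mul_zero] at h1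
    rw [← hg0]
    exact ((hg.smooth.continuousOn.continuousAt (isOpen_Ioo.mem_nhds h0mem)).tendsto).comp h1
  have hρp0 : ρp ≠ 0 := by
    have := hg.pos 0 h0mem
    rw [hg0] at this
    exact this.ne'
  have key : ∀ x y z : ℝ, x ≠ 0 → y ≠ 0 → x * y * (z * y⁻¹ / x) = z := fun x y z hx hy => by
    field_simp
  refine ⟨⟨hρs, (contDiffOn_const.mul hvs).div hσ.smooth.contDiffOn
    fun r hr => (hσ.pos r hr).ne', hρ0⟩, ?_, ?_, hρlim, ?_, ?_⟩
  · intro r hr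
    rw [EventuallyEq.deriv_eq (f := fun _ => A)]
    · simp
    · filter_upwards [Ici_mem_nhds hr] with s hs
      exact key (s ^ (n - 1)) (ρ s) A (hσ.pos s hs).ne' (hρ0 s hs).ne'
  · intro r hr
    have hv0 := inv_pos.2 (hρ0 r hr.le)
    have hvd : HasDerivAt (fun r => (ρ r)⁻¹) (deriv (fun r => (ρ r)⁻¹) r) r :=
      ((hvs.differentiableOn (by simp)).differentiableAt (Ici_mem_nhds hr)).hasDerivAt
    rw [momentum_eq (A := A) (p := p) (ρ := ρ) (v := fun r => (ρ r)⁻¹) hσ hr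
      (fun t _ => by simp) (fun t _ => rfl) hv0 hvd (hp.hasDerivAt_inv hv0)]
    have h1 := hasDerivAt_bernoulli (A := A) (h := h) hσ hg.hasDerivAt hr hv0 hvd
    have h2 : HasDerivAt (fun s : ℝ => h ((ρ s)⁻¹)⁻¹ + A ^ 2 / (s ^ (n - 1)) ^ 2 / 2 *
        (ρ s)⁻¹ ^ 2) 0 r := by
      refine (hasDerivAt_const r (0 : ℝ)).congr_of_eventuallyEq ?_
      filter_upwards [Ici_mem_nhds hr] with s hs'
      simpa using hg.bernoulli _ (hs s hs')
    exact (mul_eq_zero.1 (h1.unique h2)).resolve_left hv0.ne'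
  · have := (hσ.lim.const_mul A).mul (hρlim.inv₀ hρp0)
    simp only [mul_zero, zero_mul] at this
    refine this.congr fun r => ?_
    ring
  · have h1 := (hσ.pos a le_rfl).ne'
    have h2 := key (a ^ (n - 1)) (ρ a) A h1 (hρ0 a le_rfl).ne'
    rw [mul_assoc, hA] at h2
    exact mul_left_cancel₀ h1 h2

end

/-! ### The boundary layer problem -/

theorem isDuct_one : IsDuct 0 1 (fun _ => 1) where
  smooth := contDiff_const
  pos _ _ := one_pos
  mono _ _ := by simp
  lim := by simp

theorem isViscousDuctFlow_one_iff {p ρ u : ℝ → ℝ} {ρinf uinf ρm um : ℝ} :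
    IsViscousDuctFlow 0 1 (fun _ => 1) p ρinf uinf ρm um ρ u ↔
      IsBoundaryLayerSolution p ρinf uinf ρm um ρ u :=
  ⟨fun h => ⟨h.toIsSmoothState, by simpa using h.mass, by simpa using h.momentum, h.density_far,
    h.velocity_far, h.density_bdry, h.velocity_bdry⟩,
  fun h => ⟨h.toIsSmoothState, by simpa using h.mass, by simpa using h.momentum, h.density_far,
    h.velocity_far, h.density_bdry, h.velocity_bdry⟩⟩

theorem isViscousDuctFlow_pow_iff {n : ℕ} {r₀ μ : ℝ} {p ρ u : ℝ → ℝ} {ρinf uinf ρm um : ℝ} :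
    IsViscousDuctFlow r₀ μ (fun r => r ^ (n - 1)) p ρinf uinf ρm um ρ u ↔
      IsNavierStokesSolution n r₀ μ p ρinf uinf ρm um ρ u :=
  ⟨fun h => ⟨h.toIsSmoothState, h.mass, h.momentum, h.density_far,
    h.velocity_far, h.density_bdry, h.velocity_bdry⟩,
  fun h => ⟨h.toIsSmoothState, h.mass, h.momentum, h.density_far,
    h.velocity_far, h.density_bdry, h.velocity_bdry⟩⟩

section

variable {p : ℝ → ℝ} {vb δ ν K M ε : ℝ}

theorem ductForce_one (ε c : ℝ) (q v : ℝ → ℝ) (y : ℝ) :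
    ductForce (fun _ => 1) ε c q v y = ε ^ 2 * v y + q (v y) - c := by
  simp [ductForce]

theorem IsPressureWindow.mem_of_slope_mul_le {q : ℝ → ℝ} (hq : IsPressureWindow q vb δ ν K M)
    {w : ℝ} (hw : K * |w - vb| ≤ ν * δ / 32) : |w - vb| ≤ δ / 32 := by
  have h1 := hq.slope_pos
  have h2 : ν * |w - vb| ≤ K * |w - vb| :=
    mul_le_mul_of_nonneg_right hq.slope_le (abs_nonneg _)
  nlinarith

/-- Well-posedness of the boundary layer problem, and exponential decay at the rate
`ν / (2 ε)`, where `ε` is the mass flux. -/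
theorem exists_boundaryLayer (hp : IsPressureLaw p)
    (hq : IsPressureWindow (fun x => p x⁻¹) vb δ ν K M) (hε : 0 < ε)
    (hs : ε ^ 2 * vb ≤ ν * δ / 16) {w v₀ : ℝ} (hw : K * |w - vb| ≤ ν * δ / 32)
    (hv₀ : |v₀ - vb| < δ) :
    ∃ v ∈ tube 0 vb δ, v 0 = v₀ ∧
      (∀ y, 0 < y →
        HasDerivAt v (ε⁻¹ * (ε ^ 2 * (v y - w) + (p (v y)⁻¹ - p w⁻¹))) y) ∧
      (∀ y, 0 ≤ y → |v y - w| ≤ |v₀ - w| * Real.exp (-(ν / 2 / ε) * y)) ∧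
      IsTheUniquePair 0 (IsBoundaryLayerSolution p w⁻¹ (ε * w) v₀⁻¹ (ε * v₀))
        (fun y => (v y)⁻¹) (fun y => ε * v y) := by
  have hvb := hq.center_pos
  have hδ := hq.radius_pos
  have hw32 := hq.mem_of_slope_mul_le hw
  have hwδ : |w - vb| ≤ δ := by linarith
  have hs' : ε ^ 2 / (fun _ : ℝ => (1 : ℝ)) 0 ^ 2 * vb ≤ ν * δ / 16 := by simpa using hs
  have hε2 : ε ^ 2 ≤ ν / 32 := by simpa using hq.coeff_le (σ := fun _ => 1) (a := 0) hs'
  have hc : |p vb⁻¹ - (ε ^ 2 * 1 ^ 2 * w + p w⁻¹)| ≤ ν * δ / 8 := by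
    have h1 : |p vb⁻¹ - p w⁻¹| ≤ K * |w - vb| := by
      rw [abs_sub_comm w]
      exact hq.abs_sub_le (x := vb) (by simpa using hδ.le) hwδ
    have h2 : ε ^ 2 * w ≤ ε ^ 2 * (3 / 2 * vb) :=
      mul_le_mul_of_nonneg_left (hq.le_of_mem hwδ).2 (sq_nonneg ε)
    have h3 : 0 ≤ ε ^ 2 * w := mul_nonneg (sq_nonneg ε) (hq.pos hwδ).le
    have h4 := abs_le.1 (h1.trans hw)
    have := mul_pos hq.slope_pos hδ
    refine abs_le.2 ⟨?_, ?_⟩ <;> linarith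
  obtain ⟨v, hv, hva, hvd, hu⟩ := exists_isTheUniquePair_viscousDuctFlow isDuct_one hp hq hs' hwδ
    hc one_pos hε hv₀
  have hvd' : ∀ y, 0 < y →
      HasDerivAt v (ε⁻¹ * (ε ^ 2 * (v y - w) + (p (v y)⁻¹ - p w⁻¹))) y := by
    intro y hy
    convert! hvd y hy using 1
    rw [ductForce_one]
    ring
  refine ⟨v, hv, hva, hvd', ?_, ?_⟩
  · -- The quantity `(v - w) ^ 2 * exp (ν y / ε)` is nonincreasing.
    set f : ℝ → ℝ := fun y => (v y - w) ^ 2 * Real.exp (ν / ε * y) with hf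
    have hfd : ∀ y, 0 < y → HasDerivAt f ((2 * (v y - w) *
        (ε⁻¹ * (ε ^ 2 * (v y - w) + (p (v y)⁻¹ - p w⁻¹))) + ν / ε * (v y - w) ^ 2) *
          Real.exp (ν / ε * y)) y := by
      intro y hy
      convert! (((hvd' y hy).sub_const w).pow 2).mul
        (((hasDerivAt_id y).const_mul (ν / ε)).exp) using 1
      simp
      ring
    have hanti : AntitoneOn f (Ici 0) := by
      refine antitoneOn_of_deriv_nonpos (convex_Ici 0) ?_ ?_ ?_
      · exact ((hv.1.sub continuousOn_const).pow 2).mul (by fun_prop)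
      · intro y hy
        exact (hfd y (by simpa using hy)).differentiableAt.differentiableWithinAt
      · intro y hy
        have hy' : 0 < y := by simpa using hy
        rw [(hfd y hy').deriv]
        refine mul_nonpos_of_nonpos_of_nonneg ?_ (Real.exp_pos _).le
        have hprod : (v y - w) * (p (v y)⁻¹ - p w⁻¹) ≤ -ν * (v y - w) ^ 2 := by
          rcases le_total (v y) w with h | h
          · have := (hq.mem_sub (hv.2 y hy'.le) hwδ h).1
            nlinarith [mul_le_mul_of_nonneg_left this (sub_nonneg.2 h)]
          · have := (hq.mem_sub hwδ (hv.2 y hy'.le) h).1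
            nlinarith [mul_le_mul_of_nonneg_left this (sub_nonneg.2 h)]
        have hsq : ε ^ 2 * (v y - w) ^ 2 ≤ ν / 32 * (v y - w) ^ 2 :=
          mul_le_mul_of_nonneg_right hε2 (sq_nonneg _)
        have hνsq := mul_nonneg hq.slope_pos.le (sq_nonneg (v y - w))
        have hin : 2 * (ε ^ 2 * (v y - w) ^ 2 + (v y - w) * (p (v y)⁻¹ - p w⁻¹)) +
            ν * (v y - w) ^ 2 ≤ 0 := by linarith
        calc _ = ε⁻¹ * (2 * (ε ^ 2 * (v y - w) ^ 2 + (v y - w) * (p (v y)⁻¹ - p w⁻¹)) +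
            ν * (v y - w) ^ 2) := by ring
          _ ≤ 0 := mul_nonpos_of_nonneg_of_nonpos (inv_pos.2 hε).le hin
    intro y hy
    have h1 := hanti self_mem_Ici hy hy
    simp only [hf, hva, mul_zero, Real.exp_zero, mul_one] at h1
    have h2 : Real.exp (ν / ε * y) = Real.exp (ν / 2 / ε * y) ^ 2 := by
      rw [← Real.exp_nat_mul]; congr 1; push_cast; ring
    rw [h2, ← mul_pow] at h1
    have h3 := sq_le_sq.1 h1
    rw [abs_mul, abs_of_pos (Real.exp_pos _)] at h3
    have h4 : Real.exp (-(ν / 2 / ε) * y) = (Real.exp (ν / 2 / ε * y))⁻¹ := by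
      rw [← Real.exp_neg]; congr 1; ring
    rw [h4, ← div_eq_mul_inv, le_div_iff₀ (Real.exp_pos _)]
    exact h3
  · simp only [div_one, mul_one] at hu
    exact ⟨isViscousDuctFlow_one_iff.1 hu.1, fun ρ₁ u₁ h₁ =>
      hu.2 ρ₁ u₁ (isViscousDuctFlow_one_iff.2 h₁)⟩

end

/-! ### The Euler flow as a solution of the inviscid balance -/

section

variable {a τ : ℝ} {σ : ℝ → ℝ} {p : ℝ → ℝ} {vb δ ν K M ε Λ : ℝ}

/-- The specific volume of an inviscid flow annihilates the integrated force. -/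
theorem ductForce_eq_zero_of_inviscid (hσ : IsDuct a τ σ) (hp : IsPressureLaw p) {A w : ℝ}
    (hw : 0 < w) {v : ℝ → ℝ} (hv : ContinuousOn v (Ici a)) (hv0 : ∀ r, a ≤ r → 0 < v r)
    (hd : ∀ r, a < r → HasDerivAt v (deriv v r) r) (hlim : Tendsto v atTop (𝓝 w))
    (hm : ∀ r, a < r → (A ^ 2 / σ r ^ 2 + deriv (fun x => p x⁻¹) (v r)) * deriv v r -
      A ^ 2 * deriv σ r / σ r ^ 3 * v r = 0) {r : ℝ} (hr : a < r) :
    ductForce σ A (A ^ 2 * τ ^ 2 * w + p w⁻¹) (fun x => p x⁻¹) v r = 0 := by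
  obtain ⟨B, hB⟩ := exists_abs_le_of_tendsto hv hlim
  have hFd := fun s (hs : a < s) => hasDerivAt_ductForce (A := A)
    (c := A ^ 2 * τ ^ 2 * w + p w⁻¹) hσ hv hB hs (hd s hs)
    (hp.hasDerivAt_inv (hv0 s hs.le)).differentiableAt.hasDerivAt
  obtain ⟨L, hL⟩ := isOpen_Ioi.exists_is_const_of_deriv_eq_zero isPreconnected_Ioi
    (fun s hs => (hFd s hs).differentiableAt.differentiableWithinAt)
    (fun s hs => (hFd s hs).deriv.trans (hm s hs))
  have h1 := tendsto_ductForce (A := A) (c := A ^ 2 * τ ^ 2 * w + p w⁻¹) hσ hv hlim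
    (hp.hasDerivAt_inv hw).continuousAt
  rw [sub_self] at h1
  rw [hL r hr]
  refine tendsto_nhds_unique (tendsto_const_nhds.congr' ?_) h1
  filter_upwards [eventually_gt_atTop a] with s hs
  exact (hL s hs).symm

/-! ### The composite approximation -/

theorem one_sub_div_le (hσ : IsDuct a τ σ) (hΛ : ∀ r, a ≤ r → deriv σ r ≤ Λ * σ r) {r : ℝ}
    (hr : a ≤ r) : 1 - σ a / σ r ≤ Λ * (r - a) := by
  have hσa := hσ.pos a le_rfl
  have hd : ∀ s, a ≤ s → HasDerivAt (fun s => -(σ a / σ s)) (σ a * deriv σ s / σ s ^ 2) s := by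
    intro s hs
    have := (hσ.pos s hs).ne'
    convert! ((hasDerivAt_const s (σ a)).div (hσ.hasDerivAt s) this).neg using 1
    ring
  have h := (convex_Ici a).image_sub_le_mul_sub_of_deriv_le (C := Λ)
    (fun s hs => (hd s hs).continuousAt.continuousWithinAt)
    (fun s hs => (hd s (interior_subset hs)).differentiableAt.differentiableWithinAt)
    (fun s hs => by
      have hs' : a ≤ s := interior_subset hs
      have hσs := hσ.pos s hs'
      have hΛ0 : 0 ≤ Λ := nonneg_of_mul_nonneg_left ((hσ.mono a le_rfl).trans (hΛ a le_rfl)) hσa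
      rw [(hd s hs').deriv, div_le_iff₀ (pow_pos hσs 2)]
      have h1 := mul_le_mul (hσ.le_apply hs') (hΛ s hs') (hσ.mono s hs') hσs.le
      linarith) a self_mem_Ici r hr hr
  rw [div_self hσa.ne'] at h
  linarith

theorem mul_exp_neg_le {β x : ℝ} (hβ : 0 < β) : x * Real.exp (-β * x) ≤ 1 / β := by
  have h1 := Real.add_one_le_exp (β * x)
  rw [neg_mul, Real.exp_neg, ← div_eq_mul_inv, div_le_div_iff₀ (Real.exp_pos _) hβ]
  linarith

/-- The residual of the composite approximation `v_E(r) + v_B((r - a) / μ) - v_E(a)` is `O(μ)`,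
because the boundary layer is concentrated in `r - a = O(μ)`, where the cross-section and the Euler
flow are nearly constant. Stability of damped equations then bounds the error by `O(μ)`. -/
theorem abs_sub_composite_le (hσ : IsDuct a τ σ) (hΛ : ∀ r, a ≤ r → deriv σ r ≤ Λ * σ r)
    (hq : IsPressureWindow (fun x => p x⁻¹) vb δ ν K M) (hε : 0 < ε) (hε1 : ε ≤ 1)
    (hs : ε ^ 2 * vb ≤ ν * δ / 16) {A c : ℝ} (hA : A = σ a * ε) (hc : |p vb⁻¹ - c| ≤ ν * δ / 8)
    {vE vB v : ℝ → ℝ} {μ v₀ : ℝ} (hμ : 0 < μ) (hv₀ : |v₀ - vb| ≤ δ / 4)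
    (hEc : ContinuousOn vE (Ici a)) (hE : ∀ r, a ≤ r → |vE r - vb| ≤ δ / 32)
    (hEd : ∀ r, a < r → HasDerivAt vE (deriv vE r) r)
    (hE' : ∀ r, a < r → |deriv vE r| ≤ Λ * δ)
    (hEF : ∀ r, a < r → ductForce σ A c (fun x => p x⁻¹) vE r = 0)
    (hB : vB ∈ tube 0 vb δ) (hB0 : vB 0 = v₀)
    (hBd : ∀ y, 0 < y →
      HasDerivAt vB (ε⁻¹ * (ε ^ 2 * (vB y - vE a) + (p (vB y)⁻¹ - p (vE a)⁻¹))) y)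
    (hBdec : ∀ y, 0 ≤ y → |vB y - vE a| ≤ |v₀ - vE a| * Real.exp (-(ν / 2 / ε) * y))
    (hv : v ∈ tube a vb δ) (hva : v a = v₀)
    (hvd : ∀ r, a < r → HasDerivAt v
      (σ r / (μ * A) * ductForce σ A c (fun x => p x⁻¹) v r) r) :
    ∀ r, a ≤ r →
      |vE r - vE a| ≤ Λ * δ * (r - a) ∧
      (r - a) * |vB ((r - a) / μ) - vE a| ≤ 2 * δ / ν * μ ∧
      |v r - (vE r + (vB ((r - a) / μ) - vE a))| ≤
        2 / ν * (Λ * δ * (1 + 2 / ν * (3 * K + M * δ))) * μ := by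
  have hδ := hq.radius_pos
  have hν := hq.slope_pos
  have hσa := hσ.pos a le_rfl
  have hA0 : 0 < A := hA ▸ mul_pos hσa hε
  have hcoef : A ^ 2 / σ a ^ 2 = ε ^ 2 := by
    rw [hA]; field_simp
  have hs' : A ^ 2 / σ a ^ 2 * vb ≤ ν * δ / 16 := by rw [hcoef]; exact hs
  have hε2 : ε ^ 2 ≤ ν / 32 := hcoef ▸ hq.coeff_le hs'
  have hεK : ε ^ 2 ≤ K := by linarith [hq.slope_le]
  have hF := isDamped_ductForce hσ hq hs' hc
  have hM := hq.lipschitz_nonneg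
  have hΛ0 : 0 ≤ Λ := nonneg_of_mul_nonneg_left ((hσ.mono a le_rfl).trans (hΛ a le_rfl)) hσa
  set w := vE a with hw
  have hwE := hE a le_rfl
  have hD : |v₀ - w| ≤ δ / 2 := by
    have h1 := abs_le.1 hv₀
    have h2 := abs_le.1 hwE
    exact abs_le.2 ⟨by linarith, by linarith⟩
  set β := ν / 2 / (μ * ε) with hβ
  have hβ0 : 0 < β := by positivity
  set d : ℝ → ℝ := fun r => vB ((r - a) / μ) - w with hd
  have hyn : ∀ r, a ≤ r → 0 ≤ (r - a) / μ := fun r hr => div_nonneg (sub_nonneg.2 hr) hμ.le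
  have hdexp : ∀ r, a ≤ r → |d r| ≤ δ / 2 * Real.exp (-β * (r - a)) := by
    intro r hr
    have h1 := hBdec _ (hyn r hr)
    have h2 : -(ν / 2 / ε) * ((r - a) / μ) = -β * (r - a) := by
      rw [hβ]; field_simp
    rw [h2] at h1
    exact h1.trans (mul_le_mul_of_nonneg_right hD (Real.exp_pos _).le)
  have hd2 : ∀ r, a ≤ r → |d r| ≤ δ / 2 := fun r hr => (hdexp r hr).trans
    (mul_le_of_le_one_right (by positivity) (Real.exp_le_one_iff.2
      (by nlinarith [mul_nonneg hβ0.le (sub_nonneg.2 hr)])))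
  have hβinv : 1 / β = 2 / ν * (μ * ε) := by rw [hβ]; field_simp
  have hμε : μ * ε ≤ μ := mul_le_of_le_one_right hμ.le hε1
  have hrd : ∀ r, a ≤ r → (r - a) * |d r| ≤ δ / 2 * (2 / ν * μ) := by
    intro r hr
    have h1 := mul_le_mul_of_nonneg_left (hdexp r hr) (sub_nonneg.2 hr)
    have h2 := mul_le_mul_of_nonneg_left (mul_exp_neg_le (x := r - a) hβ0)
      (by positivity : 0 ≤ δ / 2)
    rw [hβinv] at h2
    have h3 : δ / 2 * (2 / ν * (μ * ε)) ≤ δ / 2 * (2 / ν * μ) := by gcongr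
    linarith
  have hEdiff : ∀ r, a ≤ r → |vE r - w| ≤ Λ * δ * (r - a) := by
    intro r hr
    refine abs_le.2 ⟨?_, ?_⟩
    · have := (convex_Ici a).mul_sub_le_image_sub_of_le_deriv hEc (C := -(Λ * δ))
        (fun s hs => (hEd s (by simpa using hs)).differentiableAt.differentiableWithinAt)
        (fun s hs => (abs_le.1 (hE' s (by simpa using hs))).1) a self_mem_Ici r hr hr
      linarith
    · exact (convex_Ici a).image_sub_le_mul_sub_of_deriv_le hEc
        (fun s hs => (hEd s (by simpa using hs)).differentiableAt.differentiableWithinAt)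
        (fun s hs => (abs_le.1 (hE' s (by simpa using hs))).2) a self_mem_Ici r hr hr
  have hdc : ContinuousOn d (Ici a) :=
    (hB.1.comp (by fun_prop) fun r hr => hyn r hr).sub continuousOn_const
  set va : ℝ → ℝ := fun r => vE r + d r with hva'
  have hvat : va ∈ tube a vb δ := by
    refine ⟨hEc.add hdc, fun r hr => ?_⟩
    have h1 := abs_le.1 (hE r hr)
    have h2 := abs_le.1 (hd2 r hr)
    exact abs_le.2 ⟨by simp only [hva']; linarith, by simp only [hva']; linarith⟩
  have hEb : ∀ r, a ≤ r → |vE r - vb| ≤ δ := fun r hr => (hE r hr).trans (by linarith)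
  have hEt : vE ∈ tube a vb δ := ⟨hEc, hEb⟩
  set N : ℝ → ℝ := fun r => ∫ s in Ioi r, A ^ 2 * deriv σ s / σ s ^ 3 * d s with hN
  -- The nonlocal term of the boundary layer is small, since the layer has width `O(μ)`.
  have hNb : ∀ r, a ≤ r → |N r| ≤ K * Λ * (δ / 2) * (2 / ν * μ) := by
    intro r hr
    have hint : IntegrableOn (fun s => Real.exp (-β * s)) (Ioi r) :=
      integrableOn_exp_mul_Ioi (neg_lt_zero.2 hβ0) r
    have h1 := norm_integral_le_of_norm_le (μ := volume.restrict (Ioi r))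
      (f := fun s => A ^ 2 * deriv σ s / σ s ^ 3 * d s)
      (hint.const_mul (K * Λ * (δ / 2) * Real.exp (β * a)))
      ((ae_restrict_iff' measurableSet_Ioi).2 (ae_of_all _ fun s hs => by
        have hs' : a ≤ s := hr.trans (le_of_lt hs)
        have hσs := hσ.pos s hs'
        rw [norm_mul, Real.norm_eq_abs, Real.norm_eq_abs, abs_of_nonneg (hσ.kernel_nonneg A hs')]
        have h2 : A ^ 2 * deriv σ s / σ s ^ 3 ≤ K * Λ := by
          have h3 : A ^ 2 * deriv σ s / σ s ^ 3 = A ^ 2 / σ s ^ 2 * (deriv σ s / σ s) := by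
            field_simp
          rw [h3]
          refine mul_le_mul ((hσ.coeff_le A hs').trans (hcoef.le.trans hεK)) ?_
            (div_nonneg (hσ.mono s hs') hσs.le) ((sq_nonneg ε).trans hεK)
          rw [div_le_iff₀ hσs]
          exact hΛ s hs'
        have h4 := mul_le_mul h2 (hdexp s hs') (abs_nonneg _)
          (mul_nonneg ((sq_nonneg ε).trans hεK) hΛ0)
        refine h4.trans_eq ?_
        rw [show -β * (s - a) = β * a + -β * s by ring, Real.exp_add]
        ring))
    rw [integral_const_mul, integral_exp_mul_Ioi (neg_lt_zero.2 hβ0)] at h1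
    refine h1.trans ?_
    have h5 : Real.exp (β * a) * Real.exp (-β * r) ≤ 1 := by
      rw [← Real.exp_add, Real.exp_le_one_iff]
      nlinarith [mul_nonneg hβ0.le (sub_nonneg.2 hr)]
    have hKn : 0 ≤ K := (sq_nonneg ε).trans hεK
    calc K * Λ * (δ / 2) * Real.exp (β * a) * (-Real.exp (-β * r) / -β)
        = K * Λ * (δ / 2) * ((Real.exp (β * a) * Real.exp (-β * r)) * (1 / β)) := by
          field_simp
      _ ≤ K * Λ * (δ / 2) * (1 * (2 / ν * μ)) := by
          rw [hβinv]
          gcongr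
      _ = _ := by ring
  set E : ℝ → ℝ := fun r => μ * A / σ r * deriv vE r +
    σ a / σ r * (ε ^ 2 * d r + (p (w + d r)⁻¹ - p w⁻¹)) -
      ductForce σ A c (fun x => p x⁻¹) va r with hEdef
  have hvad : ∀ r, a < r → HasDerivAt va
      (σ r / (μ * A) * (ductForce σ A c (fun x => p x⁻¹) va r + E r)) r := by
    intro r hr
    have hσr := (hσ.pos r hr.le).ne'
    have h1 := (hBd ((r - a) / μ) (div_pos (sub_pos.2 hr) hμ)).comp r
      (((hasDerivAt_id r).sub_const a).div_const μ)
    have h2 := (hEd r hr).add (h1.sub_const w)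
    convert! h2 using 1
    have h3 : vB ((r - a) / μ) = w + d r := by simp only [hd]; ring
    simp only [hEdef, h3, add_sub_cancel_left, add_sub_cancel, hA]
    field_simp
  have hFva : ∀ r, a < r → ductForce σ A c (fun x => p x⁻¹) va r =
      A ^ 2 / σ r ^ 2 * d r + (p (vE r + d r)⁻¹ - p (vE r)⁻¹) - N r := by
    intro r hr
    have h1 := hEF r hr
    have h2 : ∫ s in Ioi r, A ^ 2 * deriv σ s / σ s ^ 3 * va s =
        (∫ s in Ioi r, A ^ 2 * deriv σ s / σ s ^ 3 * vE s) + N r := by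
      simp only [hva', mul_add, hN]
      exact integral_add
        ((hσ.integrableOn_kernel_mul A hEc (hq.abs_le_of_mem_tube hEt)).mono_set
          (Ioi_subset_Ioi hr.le))
        ((hσ.integrableOn_kernel_mul A hdc hd2).mono_set (Ioi_subset_Ioi hr.le))
    unfold ductForce at h1 ⊢
    rw [h2]
    simp only [hva']
    linear_combination h1
  have hEb' : ∀ r, a < r → |E r| ≤ Λ * δ * (1 + 2 / ν * (3 * K + M * δ)) * μ := by
    intro r hr
    have hσr := hσ.pos r hr.le
    have hra := sub_pos.2 hr
    set κ := σ a / σ r with hκ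
    have hκ0 : 0 < κ := div_pos hσa hσr
    have hκ1 : κ ≤ 1 := (div_le_one hσr).2 (hσ.le_apply hr.le)
    have hκ2 : 1 - κ ≤ Λ * (r - a) := one_sub_div_le hσ hΛ hr.le
    have hAκ : A / σ r = κ * ε := by rw [hA, hκ]; ring
    have hb : A ^ 2 / σ r ^ 2 = κ ^ 2 * ε ^ 2 := by rw [← div_pow, hAκ]; ring
    have hwd : |w + d r - vb| ≤ δ := by
      have h1 := abs_le.1 hwE
      have h2 := abs_le.1 (hd2 r hr.le)
      exact abs_le.2 ⟨by linarith, by linarith⟩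
    have hwb : |w - vb| ≤ δ := hEb a le_rfl
    have hsec := hq.abs_second_diff_le (hEb r hr.le) hwb (hvat.2 r hr.le) hwd
    have hqd : |p (w + d r)⁻¹ - p w⁻¹| ≤ K * |d r| := by
      simpa using hq.abs_sub_le hwd hwb
    have hEq : E r = μ * (κ * ε) * deriv vE r + ε ^ 2 * κ * ((1 - κ) * d r)
        - (p (vE r + d r)⁻¹ - p (vE r)⁻¹ - (p (w + d r)⁻¹ - p w⁻¹))
        - (1 - κ) * (p (w + d r)⁻¹ - p w⁻¹) + N r := by
      simp only [hEdef]
      rw [hFva r hr, hb, mul_div_assoc, hAκ]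
      ring
    have hX := hrd r hr.le
    set X := (r - a) * |d r| with hXdef
    have hX0 : 0 ≤ X := mul_nonneg hra.le (abs_nonneg _)
    have hκn : 0 ≤ 1 - κ := by linarith
    have hκd : (1 - κ) * |d r| ≤ Λ * X := by
      have := mul_le_mul_of_nonneg_right hκ2 (abs_nonneg (d r))
      rw [hXdef]; linarith
    have t1 : |μ * (κ * ε) * deriv vE r| ≤ μ * (Λ * δ) := by
      rw [abs_mul, abs_of_pos (by positivity)]
      have : μ * (κ * ε) ≤ μ := mul_le_of_le_one_right hμ.le (mul_le_one₀ hκ1 hε.le hε1)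
      exact mul_le_mul this (hE' r hr) (abs_nonneg _) hμ.le
    have t2 : |ε ^ 2 * κ * ((1 - κ) * d r)| ≤ K * (Λ * X) := by
      rw [abs_mul, abs_mul, abs_mul, abs_of_nonneg hκn, abs_of_pos hκ0,
        abs_of_nonneg (sq_nonneg ε)]
      exact mul_le_mul ((mul_le_of_le_one_right (sq_nonneg ε) hκ1).trans hεK) hκd
        (mul_nonneg hκn (abs_nonneg _)) ((sq_nonneg ε).trans hεK)
    have t3 : |p (vE r + d r)⁻¹ - p (vE r)⁻¹ - (p (w + d r)⁻¹ - p w⁻¹)| ≤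
        M * (Λ * δ * X) := by
      refine hsec.trans ?_
      rw [mul_assoc]
      refine mul_le_mul_of_nonneg_left ?_ hM
      have := mul_le_mul_of_nonneg_right (hEdiff r hr.le) (abs_nonneg (d r))
      rw [hXdef]; linarith
    have t4 : |(1 - κ) * (p (w + d r)⁻¹ - p w⁻¹)| ≤ K * (Λ * X) := by
      rw [abs_mul, abs_of_nonneg hκn]
      have h1 := mul_le_mul_of_nonneg_left hqd hκn
      have h2 := mul_le_mul_of_nonneg_left hκd ((sq_nonneg ε).trans hεK)
      linarith
    have t5 := hNb r hr.le
    have hsum : |E r| ≤ μ * (Λ * δ) + K * (Λ * X) + M * (Λ * δ * X) + K * (Λ * X) +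
        K * Λ * (δ / 2) * (2 / ν * μ) := by
      rw [hEq]
      refine (abs_add_le _ _).trans (add_le_add ((abs_sub _ _).trans (add_le_add
        ((abs_sub _ _).trans (add_le_add ((abs_add_le _ _).trans (add_le_add t1 t2)) t3)) t4)) t5)
    have hKn : 0 ≤ K := (sq_nonneg ε).trans hεK
    have hcoefX : 0 ≤ 2 * K * Λ + M * (Λ * δ) := by positivity
    have h6 := mul_le_mul_of_nonneg_left hX hcoefX
    have h7 : 0 ≤ Λ * δ * (2 / ν * μ) * (3 / 2 * K + M * δ / 2) := by positivity
    have h8 : μ * (Λ * δ) + (2 * K * Λ + M * (Λ * δ)) * (δ / 2 * (2 / ν * μ)) +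
        K * Λ * (δ / 2) * (2 / ν * μ) + Λ * δ * (2 / ν * μ) * (3 / 2 * K + M * δ / 2) =
          Λ * δ * (1 + 2 / ν * (3 * K + M * δ)) * μ := by ring
    linarith
  have hfinal := hF.abs_sub_le (fun r hr => div_pos (hσ.pos r hr.le) (mul_pos hμ hA0)) hv hvat
    (by simp [hva, hva', hd, hB0, hw]) hvd hvad hEb'
  intro r hr
  refine ⟨hEdiff r hr, ?_, ?_⟩
  · have := hrd r hr
    have h1 : δ / 2 * (2 / ν * μ) ≤ 2 * δ / ν * μ := by
      have : 0 ≤ δ / ν * μ := by positivity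
      have h2 : δ / 2 * (2 / ν * μ) = δ / ν * μ := by ring
      have h3 : 2 * δ / ν * μ = 2 * (δ / ν * μ) := by ring
      linarith
    linarith
  · refine (hfinal r hr).trans_eq ?_
    field_simp

end

/-! ### Uniform estimates for small data -/

theorem abs_inv_sub_inv_le {x y c : ℝ} (hc : 0 < c) (hx : c ≤ x) (hy : c ≤ y) :
    |x⁻¹ - y⁻¹| ≤ (c ^ 2)⁻¹ * |x - y| := by
  have hx0 := hc.trans_le hx
  have hy0 := hc.trans_le hy
  have h1 : x⁻¹ - y⁻¹ = (x * y)⁻¹ * (y - x) := by field_simp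
  rw [h1, abs_mul, abs_sub_comm y, abs_of_pos (inv_pos.2 (mul_pos hx0 hy0))]
  refine mul_le_mul_of_nonneg_right ?_ (abs_nonneg _)
  gcongr
  nlinarith

theorem abs_inv_second_diff_le {c e w d : ℝ} (hc : 0 < c) (he : c ≤ e) (hw : c ≤ w)
    (hed : c ≤ e + d) (hwd : c ≤ w + d) (hwd' : w + d ≤ 3 * c) (he' : e ≤ 3 * c) :
    |(e + d)⁻¹ - e⁻¹ - ((w + d)⁻¹ - w⁻¹)| ≤ 6 / c ^ 3 * (|e - w| * |d|) := by
  have he0 := hc.trans_le he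
  have hw0 := hc.trans_le hw
  have hed0 := hc.trans_le hed
  have hwd0 := hc.trans_le hwd
  have h1 : (e + d)⁻¹ - e⁻¹ - ((w + d)⁻¹ - w⁻¹) =
      (e + (w + d)) / ((e * (e + d)) * (w * (w + d))) * ((e - w) * d) := by
    field_simp
    ring
  rw [h1, abs_mul, abs_mul (e - w), abs_of_pos (by positivity)]
  refine mul_le_mul_of_nonneg_right ?_ (by positivity)
  have h2 : c ^ 4 ≤ (e * (e + d)) * (w * (w + d)) := by
    calc c ^ 4 = (c * c) * (c * c) := by ring
      _ ≤ _ := by gcongr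
  calc (e + (w + d)) / ((e * (e + d)) * (w * (w + d))) ≤ (6 * c) / c ^ 4 := by
        gcongr
        linarith
    _ = 6 / c ^ 3 := by field_simp

/-- The errors in density and velocity are controlled by the error of the composite approximation
of the specific volume, the product of the boundary layer profile `d` and the variation of the Euler
flow, and the product of `d` and the variation of the cross-section. -/
theorem abs_state_error_le {c e w d x κ ε μ E₁ E₂ E₃ : ℝ} (hc : 0 < c) (hx : c ≤ x) (he : c ≤ e)
    (hw : c ≤ w) (hed : c ≤ e + d) (hwd : c ≤ w + d) (hwd' : w + d ≤ 3 * c) (he' : e ≤ 3 * c)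
    (hκ0 : 0 ≤ κ) (hκ1 : κ ≤ 1) (hε0 : 0 ≤ ε) (hε1 : ε ≤ 1) (h₁ : |x - (e + d)| ≤ E₁ * μ)
    (h₂ : |e - w| * |d| ≤ E₂ * μ) (h₃ : (1 - κ) * |d| ≤ E₃ * μ) :
    |x⁻¹ - e⁻¹ - (w + d)⁻¹ + w⁻¹| ≤ ((c ^ 2)⁻¹ * E₁ + 6 / c ^ 3 * E₂) * μ ∧
      |κ * ε * x - κ * ε * e - ε * (w + d) + ε * w| ≤ (E₁ + E₃) * μ := by
  constructor
  · have a1 := abs_inv_sub_inv_le hc hx hed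
    have a2 := abs_inv_second_diff_le hc he hw hed hwd hwd' he'
    have a3 := mul_le_mul_of_nonneg_left h₁ (by positivity : 0 ≤ (c ^ 2)⁻¹)
    have a4 := mul_le_mul_of_nonneg_left h₂ (by positivity : 0 ≤ 6 / c ^ 3)
    have heq : x⁻¹ - e⁻¹ - (w + d)⁻¹ + w⁻¹ =
        (x⁻¹ - (e + d)⁻¹) + ((e + d)⁻¹ - e⁻¹ - ((w + d)⁻¹ - w⁻¹)) := by ring
    rw [heq]
    refine (abs_add_le _ _).trans ?_
    linarith
  · have heq : κ * ε * x - κ * ε * e - ε * (w + d) + ε * w =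
        (κ * ε) * (x - (e + d)) - ε * ((1 - κ) * d) := by ring
    have a1 : |(κ * ε) * (x - (e + d))| ≤ 1 * (E₁ * μ) := by
      rw [abs_mul, abs_of_nonneg (mul_nonneg hκ0 hε0)]
      exact mul_le_mul (mul_le_one₀ hκ1 hε0 hε1) h₁ (abs_nonneg _) zero_le_one
    have a2 : |ε * ((1 - κ) * d)| ≤ 1 * (E₃ * μ) := by
      rw [abs_mul, abs_of_nonneg hε0]
      refine mul_le_mul hε1 ?_ (abs_nonneg _) zero_le_one
      rwa [abs_mul, abs_of_nonneg (by linarith : 0 ≤ 1 - κ)]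
    rw [heq]
    refine (abs_sub _ _).trans ?_
    linarith

theorem deriv_pow_le {n : ℕ} {a r : ℝ} (ha : 0 < a) (hr : a ≤ r) :
    deriv (fun r : ℝ => r ^ (n - 1)) r ≤ ((n - 1 : ℕ) : ℝ) / a * r ^ (n - 1) := by
  have hr0 := ha.trans_le hr
  rw [deriv_pow_field]
  rcases Nat.eq_zero_or_pos (n - 1) with h | h
  · simp [h]
  · have h1 : r ^ (n - 1) = r ^ (n - 1 - 1) * r := by
      rw [← pow_succ]; congr 1; omega
    rw [h1, div_mul_eq_mul_div, le_div_iff₀ ha]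
    have : (((n - 1 : ℕ) : ℝ) * r ^ (n - 1 - 1)) * a ≤ (((n - 1 : ℕ) : ℝ) * r ^ (n - 1 - 1)) * r :=
      mul_le_mul_of_nonneg_left hr (by positivity)
    linarith

/-- The smallness conditions on the mass flux `ε` at the boundary, relative to a pressure window
and a Bernoulli branch. -/
structure IsSmallFlux (ρp δ ν K s₀ L ε : ℝ) : Prop where
  pos : 0 < ε
  le_one : ε ≤ 1
  sq_lt : ε ^ 2 < s₀
  coeff_le : ε ^ 2 * ρp⁻¹ ≤ ν * δ / 16
  density_le : L * ε ^ 2 ≤ ρp / 2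
  volume_le : K * (2 / ρp ^ 2 * (L * ε ^ 2)) ≤ ν * δ / 32

section

variable {n : ℕ} {a r₀ : ℝ} {p : ℝ → ℝ} {ρp δ ν K M s₀ L ε : ℝ} {h g : ℝ → ℝ}

/-- Quantitative properties of the Euler flow with small mass flux `ε` at the boundary. -/
theorem IsEulerSolution.estimates (hn : 2 ≤ n) (ha : 0 < a) (hp : IsPressureLaw p)
    (hρp : 0 < ρp) (hq : IsPressureWindow (fun x => p x⁻¹) ρp⁻¹ δ ν K M)
    (hg : IsBernoulliBranch p ρp h g s₀ L) (hε : IsSmallFlux ρp δ ν K s₀ L ε) {ρ u : ℝ → ℝ}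
    (hE : IsEulerSolution n a p ρp 0 ε ρ u) :
    (∀ r, a ≤ r → |ρ r - ρp| ≤ L * ((a ^ (n - 1) * ε) ^ 2 / (r ^ (n - 1)) ^ 2)) ∧
    (∀ r, a ≤ r → |(ρ r)⁻¹ - ρp⁻¹| ≤ 2 / ρp ^ 2 * (L * ε ^ 2)) ∧
    (∀ r, a ≤ r → u r = a ^ (n - 1) * ε * (ρ r)⁻¹ / r ^ (n - 1)) ∧
    ContinuousOn (fun r => (ρ r)⁻¹) (Ici a) ∧
    (∀ r, a < r → HasDerivAt (fun r => (ρ r)⁻¹) (deriv (fun r => (ρ r)⁻¹) r) r) ∧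
    (∀ r, a < r → |deriv (fun r => (ρ r)⁻¹) r| ≤ ((n - 1 : ℕ) : ℝ) / a * δ) ∧
    (∀ r, a < r → ductForce (fun r => r ^ (n - 1)) (a ^ (n - 1) * ε)
      ((a ^ (n - 1) * ε) ^ 2 * 0 ^ 2 * ρp⁻¹ + p ρp⁻¹⁻¹) (fun x => p x⁻¹)
      (fun r => (ρ r)⁻¹) r = 0) := by
  have hσ := isDuct_pow hn ha
  have hρE := hE.density_eq hn ha hp hρp hg hε.sq_lt
  set A := a ^ (n - 1) * ε with hA
  have hσa : (a ^ (n - 1)) ≠ 0 := (hσ.pos a le_rfl).ne'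
  have hcoef : A ^ 2 / (a ^ (n - 1)) ^ 2 = ε ^ 2 := by
    rw [hA, mul_pow]; field_simp
  have hb : ∀ r, a ≤ r → A ^ 2 / (r ^ (n - 1)) ^ 2 ≤ ε ^ 2 := fun r hr =>
    (hσ.coeff_le A hr).trans_eq hcoef
  have hb0 : ∀ r, 0 ≤ A ^ 2 / (r ^ (n - 1)) ^ 2 := fun r => hσ.coeff_nonneg A r
  have h1 : ∀ r, a ≤ r → |ρ r - ρp| ≤ L * (A ^ 2 / (r ^ (n - 1)) ^ 2) := by
    intro r hr
    have := hg.abs_sub_le (A ^ 2 / (r ^ (n - 1)) ^ 2)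
      ⟨by linarith [hg.radius_pos, hb0 r], by linarith [hb r hr, hε.sq_lt]⟩
    rwa [← hρE r hr, abs_of_nonneg (hb0 r)] at this
  have h1' : ∀ r, a ≤ r → |ρ r - ρp| ≤ L * ε ^ 2 := fun r hr =>
    (h1 r hr).trans (mul_le_mul_of_nonneg_left (hb r hr) hg.const_pos.le)
  have h2 : ∀ r, a ≤ r → |(ρ r)⁻¹ - ρp⁻¹| ≤ 2 / ρp ^ 2 * (L * ε ^ 2) := by
    intro r hr
    have h3 := h1' r hr
    have h4 : ρp / 2 ≤ ρ r := by linarith [(abs_le.1 (h3.trans hε.density_le)).1]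
    have h5 : (ρ r)⁻¹ - ρp⁻¹ = (ρ r * ρp)⁻¹ * (ρp - ρ r) := by
      have := (hE.density_pos r hr).ne'
      field_simp
    have hpos : 0 < ρ r * ρp := mul_pos (hE.density_pos r hr) hρp
    rw [h5, abs_mul, abs_sub_comm ρp, abs_of_pos (inv_pos.2 hpos)]
    refine mul_le_mul ?_ h3 (abs_nonneg _) (by positivity)
    rw [show 2 / ρp ^ 2 = (ρp / 2 * ρp)⁻¹ by field_simp]
    gcongr
  have hmem : ∀ r, a ≤ r → |(ρ r)⁻¹ - ρp⁻¹| ≤ δ := fun r hr => by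
    have := hq.mem_of_slope_mul_le ((mul_le_mul_of_nonneg_left (h2 r hr)
      (hq.slope_pos.le.trans hq.slope_le)).trans hε.volume_le)
    linarith [hq.radius_pos]
  have hu : ∀ r, a ≤ r → u r = A * (ρ r)⁻¹ / r ^ (n - 1) := fun r hr => by
    rw [velocity_eq_of_mass hσ hE.toIsSmoothState hE.mass hr, mul_assoc (a ^ (n - 1)),
      hE.flux_bdry]
  have hvc : ContinuousOn (fun r => (ρ r)⁻¹) (Ici a) :=
    hE.smooth_density.continuousOn.inv₀ fun s hs => (hE.density_pos s hs).ne'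
  have hvd : ∀ s, a < s → HasDerivAt (fun r => (ρ r)⁻¹) (deriv (fun r => (ρ r)⁻¹) s) s :=
    fun s hs => ((hE.differentiableAt_density hs).inv (hE.density_pos s hs.le).ne').hasDerivAt
  have hv0 : ∀ r, a ≤ r → 0 < (ρ r)⁻¹ := fun r hr => inv_pos.2 (hE.density_pos r hr)
  have hmom : ∀ r, a < r → (A ^ 2 / (r ^ (n - 1)) ^ 2 + deriv (fun x => p x⁻¹) (ρ r)⁻¹) *
      deriv (fun r => (ρ r)⁻¹) r -
        A ^ 2 * deriv (fun r : ℝ => r ^ (n - 1)) r / (r ^ (n - 1)) ^ 3 * (ρ r)⁻¹ = 0 := by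
    intro r hr
    rw [← hE.momentum r hr]
    exact (momentum_eq (A := A) (p := p) (ρ := ρ) (u := u) (v := fun r => (ρ r)⁻¹) hσ hr
      (fun t _ => by simp) hu (hv0 r hr.le) (hvd r hr)
      (hp.hasDerivAt_inv (hv0 r hr.le)).differentiableAt.hasDerivAt).symm
  refine ⟨h1, h2, hu, hvc, hvd, fun r hr => ?_, fun r hr =>
    ductForce_eq_zero_of_inviscid hσ hp (inv_pos.2 hρp) hvc hv0 hvd
      (hE.density_far.inv₀ hρp.ne') hmom hr⟩
  -- The factor of `v'` in the momentum balance is at most `-ν / 2`.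
  have hν := hq.slope_pos
  have hδ := hq.radius_pos
  have hσr := hσ.pos r hr.le
  have hε2 : ε ^ 2 ≤ ν / 32 := hcoef ▸ hq.coeff_le (a := a) (σ := fun r => r ^ (n - 1)) (A := A)
    (by simp only [hcoef]; exact hε.coeff_le)
  have hq' := (hq.deriv_mem _ (hmem r hr.le)).2
  have hfac : A ^ 2 / (r ^ (n - 1)) ^ 2 + deriv (fun x => p x⁻¹) (ρ r)⁻¹ ≤ -(ν / 2) := by
    linarith [hb r hr.le]
  set Λ : ℝ := ((n - 1 : ℕ) : ℝ) / a with hΛ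
  have hk : A ^ 2 * deriv (fun r : ℝ => r ^ (n - 1)) r / (r ^ (n - 1)) ^ 3 ≤ ε ^ 2 * Λ := by
    have h3 : A ^ 2 * deriv (fun r : ℝ => r ^ (n - 1)) r / (r ^ (n - 1)) ^ 3 =
        A ^ 2 / (r ^ (n - 1)) ^ 2 * (deriv (fun r : ℝ => r ^ (n - 1)) r / r ^ (n - 1)) := by
      have : r ^ (n - 1) ≠ 0 := hσr.ne'
      generalize deriv (fun r : ℝ => r ^ (n - 1)) r = D
      field_simp
    rw [h3]
    refine mul_le_mul (hb r hr.le) ?_ (div_nonneg (hσ.mono r hr.le) hσr.le) (sq_nonneg ε)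
    rw [div_le_iff₀ hσr]
    exact deriv_pow_le ha hr.le
  have hk0 := hσ.kernel_nonneg A hr.le
  have hΛ0 : 0 ≤ Λ := by positivity
  have hm1 := hmom r hr
  have hvle := (hq.le_of_mem (hmem r hr.le)).2
  have hkv : A ^ 2 * deriv (fun r : ℝ => r ^ (n - 1)) r / (r ^ (n - 1)) ^ 3 * (ρ r)⁻¹ ≤
      ε ^ 2 * Λ * (3 / 2 * ρp⁻¹) :=
    mul_le_mul hk hvle (hv0 r hr.le).le (by positivity)
  have h6 := mul_le_mul_of_nonneg_right hε.coeff_le hΛ0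
  have h7 := congrArg abs (sub_eq_zero.1 hm1)
  rw [abs_mul, abs_of_nonpos (by linarith : A ^ 2 / (r ^ (n - 1)) ^ 2 +
    deriv (fun x => p x⁻¹) (ρ r)⁻¹ ≤ 0), abs_of_nonneg (mul_nonneg hk0 (hv0 r hr.le).le)] at h7
  have h8 := mul_le_mul_of_nonneg_right (neg_le_neg hfac)
    (abs_nonneg (deriv (fun r => (ρ r)⁻¹) r))
  refine le_of_mul_le_mul_left (a := ν / 2) ?_ (by positivity)
  have : 0 ≤ ν * δ * Λ := by positivity
  linarith

/-- Small boundary data have small mass flux. -/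
theorem exists_small_data (hρp : 0 < ρp) (hq : IsPressureWindow (fun x => p x⁻¹) ρp⁻¹ δ ν K M)
    (hg : IsBernoulliBranch p ρp h g s₀ L) :
    ∃ ε₀ > (0 : ℝ), ∀ um ρm : ℝ, 0 < um → 0 < ρm → |um| + |ρm - ρp| ≤ ε₀ →
      IsSmallFlux ρp δ ν K s₀ L (ρm * um) ∧ ρp / 2 ≤ ρm ∧ ρm ≤ 3 / 2 * ρp ∧
      |ρm⁻¹ - ρp⁻¹| ≤ 2 / ρp ^ 2 * |ρm - ρp| ∧ |ρm⁻¹ - ρp⁻¹| ≤ δ / 4 := by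
  have hδ := hq.radius_pos
  have hν := hq.slope_pos
  have hK : 0 < K := hν.trans_le hq.slope_le
  have hL := hg.const_pos
  have hs₀ := hg.radius_pos
  set θ : ℝ := min (min (s₀ / 2) (ν * δ / 16 * ρp))
    (min (ρp / 2 / L) (ν * δ / 32 / (K * (2 / ρp ^ 2 * L)))) with hθ
  have hθ0 : 0 < θ := by positivity
  have hsq : ∀ ε : ℝ, 0 < ε → ε ≤ 1 → ε ^ 2 ≤ θ → IsSmallFlux ρp δ ν K s₀ L ε := by
    intro ε h0 hle hε
    have h1 : ε ^ 2 ≤ s₀ / 2 := hε.trans ((min_le_left _ _).trans (min_le_left _ _))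
    have h2 : ε ^ 2 ≤ ν * δ / 16 * ρp := hε.trans ((min_le_left _ _).trans (min_le_right _ _))
    have h3 : ε ^ 2 ≤ ρp / 2 / L := hε.trans ((min_le_right _ _).trans (min_le_left _ _))
    have h4 : ε ^ 2 ≤ ν * δ / 32 / (K * (2 / ρp ^ 2 * L)) :=
      hε.trans ((min_le_right _ _).trans (min_le_right _ _))
    rw [le_div_iff₀ hL] at h3
    rw [le_div_iff₀ (by positivity)] at h4
    refine ⟨h0, hle, by linarith, ?_, by linarith, by linarith⟩
    rwa [← div_eq_mul_inv, div_le_iff₀ hρp]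
  refine ⟨min (ρp / 2) (min (min 1 θ / (2 * ρp)) (δ / 4 * ρp ^ 2 / 2)), by positivity, ?_⟩
  intro um ρm hum hρm hle
  have h1 : |um| + |ρm - ρp| ≤ ρp / 2 := hle.trans (min_le_left _ _)
  have h2 : |um| + |ρm - ρp| ≤ min 1 θ / (2 * ρp) :=
    hle.trans ((min_le_right _ _).trans (min_le_left _ _))
  have h3 : |um| + |ρm - ρp| ≤ δ / 4 * ρp ^ 2 / 2 :=
    hle.trans ((min_le_right _ _).trans (min_le_right _ _))
  rw [abs_of_pos hum] at h1 h2 h3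
  have h4 := abs_nonneg (ρm - ρp)
  have h5 := abs_le.1 (by linarith : |ρm - ρp| ≤ ρp / 2)
  have hlo : ρp / 2 ≤ ρm := by linarith
  have hup : ρm ≤ 3 / 2 * ρp := by linarith
  have hflux : ρm * um ≤ min 1 θ := by
    have h6 : um ≤ min 1 θ / (2 * ρp) := by linarith
    rw [le_div_iff₀ (by positivity)] at h6
    nlinarith
  have hflux1 := hflux.trans (min_le_left _ _)
  have hflux2 := hflux.trans (min_le_right _ _)
  have hpos := mul_pos hρm hum
  have hinv : |ρm⁻¹ - ρp⁻¹| ≤ 2 / ρp ^ 2 * |ρm - ρp| := by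
    have h7 : ρm⁻¹ - ρp⁻¹ = (ρm * ρp)⁻¹ * (ρp - ρm) := by field_simp
    rw [h7, abs_mul, abs_sub_comm ρp, abs_of_pos (inv_pos.2 (mul_pos hρm hρp))]
    refine mul_le_mul_of_nonneg_right ?_ h4
    rw [show 2 / ρp ^ 2 = (ρp / 2 * ρp)⁻¹ by field_simp]
    gcongr
  refine ⟨hsq _ hpos hflux1 (by nlinarith), hlo, hup, hinv, hinv.trans ?_⟩
  have h8 : |ρm - ρp| ≤ δ / 4 * ρp ^ 2 / 2 := by linarith
  calc 2 / ρp ^ 2 * |ρm - ρp| ≤ 2 / ρp ^ 2 * (δ / 4 * ρp ^ 2 / 2) := by gcongr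
    _ = δ / 4 := by field_simp

theorem exists_euler_estimate (hn : 2 ≤ n) (hr₀ : 0 < r₀) (hp : IsPressureLaw p)
    (hρp : 0 < ρp) (hq : IsPressureWindow (fun x => p x⁻¹) ρp⁻¹ δ ν K M)
    (hg : IsBernoulliBranch p ρp h g s₀ L) :
    ∃ C > (0 : ℝ), ∀ um ρm : ℝ, 0 < um → 0 < ρm → IsSmallFlux ρp δ ν K s₀ L (ρm * um) →
      ρp / 2 ≤ ρm → ρm ≤ 3 / 2 * ρp → ∃ ρE uE : ℝ → ℝ,
        IsTheUniquePair r₀ (IsEulerSolution n r₀ p ρp 0 (ρm * um)) ρE uE ∧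
        ∀ r : ℝ, r₀ ≤ r →
          |ρE r - ρp| ≤ C * (r ^ (2 * (n - 1)))⁻¹ * |um| ^ 2 ∧
          C⁻¹ * (r ^ (n - 1))⁻¹ * |um| ≤ |uE r| ∧
          |uE r| ≤ C * (r ^ (n - 1))⁻¹ * |um| := by
  have hσ0 : 0 < r₀ ^ (n - 1) := pow_pos hr₀ _
  have hvb : 0 < ρp⁻¹ := inv_pos.2 hρp
  have hδ := hq.radius_pos
  have hK : 0 < K := hq.slope_pos.trans_le hq.slope_le
  have hL := hg.const_pos
  set S := r₀ ^ (n - 1) with hS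
  set C : ℝ := max (4 * L * S ^ 2 * ρp ^ 2) (max (4 * S) (4 / S)) with hC
  have hC0 : 0 < C := lt_max_of_lt_left (by positivity)
  refine ⟨C, hC0, ?_⟩
  intro um ρm hum hρm hε hlo hup
  have hE := hg.isEulerSolution hn hr₀ hp hε.sq_lt
  refine ⟨_, _, ⟨hE, fun ρ₁ u₁ h₁ => ?_⟩, ?_⟩
  · have h2 := h₁.density_eq hn hr₀ hp hρp hg hε.sq_lt
    obtain ⟨-, -, h3, -⟩ := h₁.estimates hn hr₀ hp hρp hq hg hε
    exact ⟨h2, fun r hr => by rw [h3 r hr, h2 r hr]⟩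
  · obtain ⟨e1, e2, -⟩ := hE.estimates hn hr₀ hp hρp hq hg hε
    intro r hr
    have hr0 : 0 < r := hr₀.trans_le hr
    have hT : 0 < r ^ (n - 1) := pow_pos hr0 _
    rw [abs_of_pos hum]
    refine ⟨(e1 r hr).trans ?_, ?_⟩
    · rw [pow_mul', ← hS]
      have h1 : (ρm * um) ^ 2 ≤ 4 * ρp ^ 2 * um ^ 2 := by
        rw [mul_pow]
        refine mul_le_mul_of_nonneg_right ?_ (sq_nonneg um)
        nlinarith
      have h2 : 4 * L * S ^ 2 * ρp ^ 2 ≤ C := le_max_left _ _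
      calc L * ((S * (ρm * um)) ^ 2 / (r ^ (n - 1)) ^ 2)
          = L * S ^ 2 * (ρm * um) ^ 2 * ((r ^ (n - 1)) ^ 2)⁻¹ := by
            rw [mul_pow, div_eq_mul_inv]; ring
        _ ≤ L * S ^ 2 * (4 * ρp ^ 2 * um ^ 2) * ((r ^ (n - 1)) ^ 2)⁻¹ := by gcongr
        _ = 4 * L * S ^ 2 * ρp ^ 2 * ((r ^ (n - 1)) ^ 2)⁻¹ * um ^ 2 := by ring
        _ ≤ _ := by gcongr
    · -- `ρ₋ / ρ_E(r)` lies between `1 / 4` and `9 / 4`.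
      have hmem := hq.mem_of_slope_mul_le ((mul_le_mul_of_nonneg_left (e2 r hr) hK.le).trans hε.volume_le)
      obtain ⟨l1, l2⟩ := hq.le_of_mem (hmem.trans (by linarith))
      generalize (g ((r₀ ^ (n - 1) * (ρm * um)) ^ 2 / (r ^ (n - 1)) ^ 2))⁻¹ = x at l1 l2
      have hx : 0 < x := lt_of_lt_of_le (by positivity) l1
      have hrw : r₀ ^ (n - 1) * (ρm * um) * x / r ^ (n - 1) =
          S * (ρm * x) * (r ^ (n - 1))⁻¹ * um := by
        rw [← hS, div_eq_mul_inv]; ring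
      have b1 : 1 / 4 ≤ ρm * x := by
        calc (1 : ℝ) / 4 = ρp / 2 * (ρp⁻¹ / 2) := by field_simp; norm_num
          _ ≤ _ := by gcongr
      have b2 : ρm * x ≤ 4 := by
        calc ρm * x ≤ 3 / 2 * ρp * (3 / 2 * ρp⁻¹) := by gcongr
          _ = 9 / 4 := by field_simp; norm_num
          _ ≤ 4 := by norm_num
      have hC1 : 4 * S ≤ C :=
        (le_max_left _ _).trans (le_max_right _ _)
      have hC2 : 4 / S ≤ C :=
        (le_max_right _ _).trans (le_max_right _ _)
      rw [hrw, abs_of_pos (by positivity)]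
      constructor
      · have h3 : C⁻¹ ≤ S * (ρm * x) := by
          calc C⁻¹ ≤ (4 / S)⁻¹ := by gcongr
            _ = S * (1 / 4) := by field_simp
            _ ≤ _ := by gcongr
        gcongr
      · have h3 : S * (ρm * x) ≤ C := by
          calc S * (ρm * x) ≤ S * 4 := by gcongr
            _ ≤ C := by linarith
        gcongr

/-- The boundary layer attached to an Euler flow, in terms of the specific volume. -/
theorem IsEulerSolution.exists_boundaryLayer (hn : 2 ≤ n) (hr₀ : 0 < r₀) (hp : IsPressureLaw p)
    (hρp : 0 < ρp) (hq : IsPressureWindow (fun x => p x⁻¹) ρp⁻¹ δ ν K M)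
    (hg : IsBernoulliBranch p ρp h g s₀ L) {um ρm : ℝ} (hρm : 0 < ρm)
    (hε : IsSmallFlux ρp δ ν K s₀ L (ρm * um)) (hη : |ρm⁻¹ - ρp⁻¹| ≤ δ / 4) {ρE uE : ℝ → ℝ}
    (hE : IsEulerSolution n r₀ p ρp 0 (ρm * um) ρE uE) :
    ∃ v ∈ tube 0 ρp⁻¹ δ, v 0 = ρm⁻¹ ∧
      (∀ y, 0 < y → HasDerivAt v ((ρm * um)⁻¹ * ((ρm * um) ^ 2 * (v y - (ρE r₀)⁻¹) +
        (p (v y)⁻¹ - p (ρE r₀)⁻¹⁻¹))) y) ∧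
      (∀ y, 0 ≤ y → |v y - (ρE r₀)⁻¹| ≤
        |ρm⁻¹ - (ρE r₀)⁻¹| * Real.exp (-(ν / 2 / (ρm * um)) * y)) ∧
      uE r₀ = ρm * um * (ρE r₀)⁻¹ ∧
      IsTheUniquePair 0 (IsBoundaryLayerSolution p (ρE r₀) (uE r₀) ρm um)
        (fun y => (v y)⁻¹) (fun y => ρm * um * v y) := by
  have hσ0 : 0 < r₀ ^ (n - 1) := pow_pos hr₀ _
  have hδ := hq.radius_pos
  have hK : 0 < K := hq.slope_pos.trans_le hq.slope_le
  obtain ⟨-, e2, e3, -⟩ := hE.estimates hn hr₀ hp hρp hq hg hε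
  have hw : K * |(ρE r₀)⁻¹ - ρp⁻¹| ≤ ν * δ / 32 :=
    (mul_le_mul_of_nonneg_left (e2 r₀ le_rfl) hK.le).trans hε.volume_le
  obtain ⟨v, hv, hv0, hvd, hvdec, hvu⟩ := _root_.exists_boundaryLayer hp hq hε.pos hε.coeff_le hw
    (v₀ := ρm⁻¹) (by linarith)
  have huE : uE r₀ = ρm * um * (ρE r₀)⁻¹ := by
    rw [e3 r₀ le_rfl, mul_assoc, mul_div_cancel_left₀ _ hσ0.ne']
  refine ⟨v, hv, hv0, hvd, hvdec, huE, ?_⟩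
  have hum' : ρm * um * ρm⁻¹ = um := by field_simp
  rwa [inv_inv, inv_inv, hum', ← huE] at hvu

theorem exists_boundaryLayer_estimate (hn : 2 ≤ n) (hr₀ : 0 < r₀) (hp : IsPressureLaw p)
    (hρp : 0 < ρp) (hq : IsPressureWindow (fun x => p x⁻¹) ρp⁻¹ δ ν K M)
    (hg : IsBernoulliBranch p ρp h g s₀ L) :
    ∃ C > (0 : ℝ), ∀ um ρm : ℝ, 0 < um → 0 < ρm → IsSmallFlux ρp δ ν K s₀ L (ρm * um) →
      ρp / 2 ≤ ρm → ρm ≤ 3 / 2 * ρp → |ρm⁻¹ - ρp⁻¹| ≤ 2 / ρp ^ 2 * |ρm - ρp| →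
      |ρm⁻¹ - ρp⁻¹| ≤ δ / 4 →
      ∀ ρE uE : ℝ → ℝ, IsEulerSolution n r₀ p ρp 0 (ρm * um) ρE uE →
      ∃ ρB uB : ℝ → ℝ,
        IsTheUniquePair 0 (IsBoundaryLayerSolution p (ρE r₀) (uE r₀) ρm um) ρB uB ∧
        ∀ y : ℝ, 0 ≤ y →
          |ρB y - ρE r₀| ≤
            C * Real.exp (-(ν / 2 / (ρm * um)) * y) * (|um| ^ 2 + |ρm - ρp|) ∧
          |uB y - uE r₀| ≤
            C * Real.exp (-(ν / 2 / (ρm * um)) * y) * (|um| ^ 2 + |ρm - ρp|) := by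
  have hvb : 0 < ρp⁻¹ := inv_pos.2 hρp
  have hδ := hq.radius_pos
  have hK : 0 < K := hq.slope_pos.trans_le hq.slope_le
  have hL := hg.const_pos
  set D : ℝ := 2 / ρp ^ 2 * (1 + 4 * L * ρp ^ 2) with hD
  have hD0 : 0 < D := by positivity
  refine ⟨(4 * ρp ^ 2 + 1) * D, by positivity, ?_⟩
  intro um ρm hum hρm hε hlo hup hinv hη ρE uE hE
  obtain ⟨-, e2, -⟩ := hE.estimates hn hr₀ hp hρp hq hg hε
  obtain ⟨v, hv, hv0, hvd, hvdec, huE, hvu⟩ := hE.exists_boundaryLayer hn hr₀ hp hρp hq hg hρm hε hη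
  refine ⟨_, _, hvu, fun y hy => ?_⟩
  have hmem := (hq.mem_of_slope_mul_le
    ((mul_le_mul_of_nonneg_left (e2 r₀ le_rfl) hK.le).trans hε.volume_le)).trans
      (by linarith : δ / 32 ≤ δ)
  set w := (ρE r₀)⁻¹ with hw
  have hjump : |ρm⁻¹ - w| ≤ D * (|um| ^ 2 + |ρm - ρp|) := by
    have h1 := abs_sub_le ρm⁻¹ ρp⁻¹ w
    have h2 := e2 r₀ le_rfl
    rw [abs_sub_comm] at h2
    have h3 : (ρm * um) ^ 2 ≤ 4 * ρp ^ 2 * um ^ 2 := by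
      rw [mul_pow]
      refine mul_le_mul_of_nonneg_right ?_ (sq_nonneg um)
      nlinarith
    have h4 : 2 / ρp ^ 2 * (L * (ρm * um) ^ 2) ≤ 2 / ρp ^ 2 * (L * (4 * ρp ^ 2 * um ^ 2)) := by
      gcongr
    have h5 : 0 ≤ 2 / ρp ^ 2 * (um ^ 2 + 4 * L * ρp ^ 2 * |ρm - ρp|) := by positivity
    rw [abs_of_pos hum, hD]
    linarith
  set J := |um| ^ 2 + |ρm - ρp| with hJ
  have hJ0 : 0 ≤ J := by positivity
  have hz : |v y - w| ≤ D * J * Real.exp (-(ν / 2 / (ρm * um)) * y) :=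
    (hvdec y hy).trans (mul_le_mul_of_nonneg_right hjump (Real.exp_pos _).le)
  set X := Real.exp (-(ν / 2 / (ρm * um)) * y) with hX
  have hX0 : 0 < X := Real.exp_pos _
  have hDXJ : 0 ≤ D * J * X := by positivity
  constructor
  · have h1 := abs_inv_sub_inv_le (by positivity : 0 < ρp⁻¹ / 2) (hq.le_of_mem (hv.2 y hy)).1
      (hq.le_of_mem hmem).1
    rw [hw, inv_inv] at h1
    have h2 : ((ρp⁻¹ / 2) ^ 2)⁻¹ = 4 * ρp ^ 2 := by field_simp; norm_num
    rw [h2] at h1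
    refine h1.trans ?_
    have h3 := mul_le_mul_of_nonneg_left hz (by positivity : 0 ≤ 4 * ρp ^ 2)
    linarith
  · rw [huE, ← mul_sub, abs_mul, abs_of_pos (mul_pos hρm hum)]
    have h3 : ρm * um * |v y - w| ≤ 1 * (D * J * X) :=
      mul_le_mul hε.le_one hz (abs_nonneg _) zero_le_one
    have h4 : 0 ≤ 4 * ρp ^ 2 * (D * J * X) := by positivity
    linarith

/-- The Navier–Stokes flow differs from the composite approximation by `O(μ)`, uniformly in the
boundary data. -/
theorem exists_navierStokes_estimate (hn : 2 ≤ n) (hr₀ : 0 < r₀) (hp : IsPressureLaw p)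
    (hρp : 0 < ρp) (hq : IsPressureWindow (fun x => p x⁻¹) ρp⁻¹ δ ν K M)
    (hg : IsBernoulliBranch p ρp h g s₀ L) :
    ∃ C > (0 : ℝ), ∀ um ρm : ℝ, 0 < ρm → IsSmallFlux ρp δ ν K s₀ L (ρm * um) →
      |ρm⁻¹ - ρp⁻¹| ≤ δ / 4 →
      ∀ ρE uE : ℝ → ℝ, IsEulerSolution n r₀ p ρp 0 (ρm * um) ρE uE →
      ∀ ρB uB : ℝ → ℝ, IsBoundaryLayerSolution p (ρE r₀) (uE r₀) ρm um ρB uB →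
      ∀ μ : ℝ, 0 < μ →
      ∃ ρ u : ℝ → ℝ,
        IsTheUniquePair r₀ (IsNavierStokesSolution n r₀ μ p ρp 0 ρm um) ρ u ∧
        ∀ r : ℝ, r₀ ≤ r →
          |ρ r - ρE r - ρB ((r - r₀) / μ) + ρE r₀| ≤ C * μ ∧
          |u r - uE r - uB ((r - r₀) / μ) + uE r₀| ≤ C * μ := by
  have hσ := isDuct_pow hn hr₀
  have hσ0 : 0 < r₀ ^ (n - 1) := hσ.pos r₀ le_rfl
  have hvb : 0 < ρp⁻¹ := inv_pos.2 hρp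
  have hδ := hq.radius_pos
  have hν := hq.slope_pos
  have hK : 0 < K := hν.trans_le hq.slope_le
  have hM := hq.lipschitz_nonneg
  set S := r₀ ^ (n - 1) with hS
  set Λ : ℝ := ((n - 1 : ℕ) : ℝ) / r₀ with hΛ
  set E₁ : ℝ := 2 / ν * (Λ * δ * (1 + 2 / ν * (3 * K + M * δ))) with hE₁
  set E₂ : ℝ := Λ * δ * (2 * δ / ν) with hE₂
  set E₃ : ℝ := Λ * (2 * δ / ν) with hE₃
  have hΛ0 : 0 ≤ Λ := by positivity
  have hE₁0 : 0 ≤ E₁ := by positivity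
  have hE₂0 : 0 ≤ E₂ := by positivity
  have hE₃0 : 0 ≤ E₃ := by positivity
  set c := ρp⁻¹ / 2 with hc
  have hc0 : 0 < c := by positivity
  refine ⟨(c ^ 2)⁻¹ * E₁ + 6 / c ^ 3 * E₂ + E₁ + E₃ + 1, by positivity, ?_⟩
  intro um ρm hρm hflux hη ρE uE hE ρB uB hB μ hμ
  obtain ⟨-, e2, e3, e4, e5, e6, e7⟩ := hE.estimates hn hr₀ hp hρp hq hg hflux
  obtain ⟨vB, hvB, hvB0, hvBd, hvBdec, huE, hvBu⟩ := hE.exists_boundaryLayer hn hr₀ hp hρp hq hg hρm hflux hη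
  obtain ⟨hρB, huB⟩ := hvBu.2 ρB uB hB
  have hε : 0 < ρm * um := hflux.pos
  set ε := ρm * um with hεdef
  have hA0 : 0 < S * ε := mul_pos hσ0 hε
  have hcoef : (S * ε) ^ 2 / (r₀ ^ (n - 1)) ^ 2 = ε ^ 2 := by
    rw [← hS]; field_simp
  have hcc : |p ρp⁻¹⁻¹ - ((S * ε) ^ 2 * 0 ^ 2 * ρp⁻¹ + p ρp⁻¹⁻¹)| ≤ ν * δ / 8 := by
    have h0 : (S * ε) ^ 2 * 0 ^ 2 * ρp⁻¹ + p ρp⁻¹⁻¹ = p ρp⁻¹⁻¹ := by ring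
    rw [h0, sub_self, abs_zero]
    positivity
  obtain ⟨v, hv, hv0, hvd, hvu⟩ := exists_isTheUniquePair_viscousDuctFlow (A := S * ε)
    (w := ρp⁻¹) (v₀ := ρm⁻¹) hσ hp hq (by simp only [hcoef]; exact hflux.coeff_le)
    (by rw [sub_self, abs_zero]; exact hδ.le) hcc hμ hA0 (by linarith)
  have hbd : S * ε * ρm⁻¹ / r₀ ^ (n - 1) = um := by
    rw [← hS, hεdef]; field_simp
  rw [inv_inv, inv_inv, mul_zero, zero_mul, hbd] at hvu
  refine ⟨_, _, ⟨isViscousDuctFlow_pow_iff.1 hvu.1, fun ρ₁ u₁ h₁ =>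
    hvu.2 ρ₁ u₁ (isViscousDuctFlow_pow_iff.2 h₁)⟩, ?_⟩
  have hE32 : ∀ r, r₀ ≤ r → |(ρE r)⁻¹ - ρp⁻¹| ≤ δ / 32 := fun r hr =>
    hq.mem_of_slope_mul_le ((mul_le_mul_of_nonneg_left (e2 r hr) hK.le).trans hflux.volume_le)
  have hcomp := abs_sub_composite_le (vE := fun r => (ρE r)⁻¹) hσ
    (fun r hr => deriv_pow_le hr₀ hr) hq hε hflux.le_one hflux.coeff_le (A := S * ε) rfl hcc hμ hη e4 hE32 e5 e6 e7
    hvB hvB0 hvBd hvBdec hv hv0 hvd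
  intro r hr
  obtain ⟨d1, d2, d3⟩ := hcomp r hr
  have hκ := one_sub_div_le hσ (fun r hr => deriv_pow_le hr₀ hr) hr
  have hκ1 : r₀ ^ (n - 1) / r ^ (n - 1) ≤ 1 := (div_le_one (hσ.pos r hr)).2 (hσ.le_apply hr)
  have hT : 0 < r ^ (n - 1) := hσ.pos r hr
  have hy : 0 ≤ (r - r₀) / μ := div_nonneg (sub_nonneg.2 hr) hμ.le
  have hvm := hq.le_of_mem (hv.2 r hr)
  have hBm := hq.le_of_mem (hvB.2 _ hy)
  have hEm := hq.le_of_mem ((hE32 r hr).trans (by linarith))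
  have hwm := hq.le_of_mem ((hE32 r₀ le_rfl).trans (by linarith))
  have hvam : c ≤ (ρE r)⁻¹ + (vB ((r - r₀) / μ) - (ρE r₀)⁻¹) := by
    have h1 := hvBdec _ hy
    have h2 : Real.exp (-(ν / 2 / ε) * ((r - r₀) / μ)) ≤ 1 :=
      Real.exp_le_one_iff.2 (mul_nonpos_of_nonpos_of_nonneg
        (neg_nonpos.2 (by positivity)) hy)
    have h3 := abs_le.1 (h1.trans (mul_le_of_le_one_right (abs_nonneg _) h2))
    have h4 := (abs_sub_le ρm⁻¹ ρp⁻¹ (ρE r₀)⁻¹)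
    rw [abs_sub_comm ρp⁻¹] at h4
    have h5 := hE32 r₀ le_rfl
    have h6 := abs_le.1 (hE32 r hr)
    have h7 := hq.radius_le
    simp only [hc]
    linarith [h3.1]
  rw [hρB hy, huB hy, e3 r hr, huE]
  set d := vB ((r - r₀) / μ) - (ρE r₀)⁻¹ with hd
  have hBeq : vB ((r - r₀) / μ) = (ρE r₀)⁻¹ + d := by rw [hd]; ring
  have hed : |(ρE r)⁻¹ - (ρE r₀)⁻¹| * |d| ≤ E₂ * μ := by
    have h1 := mul_le_mul_of_nonneg_right d1 (abs_nonneg d)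
    have h2 := mul_le_mul_of_nonneg_left d2 (by positivity : 0 ≤ Λ * δ)
    rw [hE₂]
    linarith
  have hκd : (1 - r₀ ^ (n - 1) / r ^ (n - 1)) * |d| ≤ E₃ * μ := by
    have h1 := mul_le_mul_of_nonneg_right hκ (abs_nonneg d)
    have h2 := mul_le_mul_of_nonneg_left d2 hΛ0
    rw [hE₃]
    linarith
  rw [hBeq] at hBm
  beta_reduce
  rw [hBeq]
  obtain ⟨f1, f2⟩ := abs_state_error_le (x := v r) hc0 (by linarith [hvm.1])
    (by linarith [hEm.1]) (by linarith [hwm.1]) hvam (by linarith [hBm.1])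
    (by linarith [hBm.2]) (by linarith [hEm.2]) (div_nonneg hσ0.le hT.le) hκ1 hε.le hflux.le_one d3 hed hκd
  rw [inv_inv, inv_inv] at f1
  have hX0 : 0 ≤ (c ^ 2)⁻¹ * E₁ + 6 / c ^ 3 * E₂ := by positivity
  refine ⟨f1.trans (mul_le_mul_of_nonneg_right (by linarith) hμ.le), ?_⟩
  have heq : ∀ y, S * ε * y / r ^ (n - 1) = r₀ ^ (n - 1) / r ^ (n - 1) * ε * y := fun y => by
    rw [← hS]; ring
  rw [heq, heq]
  exact f2.trans (mul_le_mul_of_nonneg_right (by linarith) hμ.le)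

end

theorem theorem1p3 (n : ℕ) (hn : 2 ≤ n) (r₀ : ℝ) (hr₀ : 0 < r₀) (p : ℝ → ℝ)
    (hp : IsPressureLaw p) (ρp : ℝ) (hρp : 0 < ρp) :
    ∃ ε₀ > (0 : ℝ), ∃ ν₀ > (0 : ℝ), ∃ C > (0 : ℝ),
      -- (I) the Euler solution
      (∀ um ρm : ℝ, 0 < um → 0 < ρm → |um| + |ρm - ρp| ≤ ε₀ →
        ∃ ρE uE : ℝ → ℝ,
          IsTheUniquePair r₀ (IsEulerSolution n r₀ p ρp 0 (ρm * um)) ρE uE ∧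
          ∀ r : ℝ, r₀ ≤ r →
            |ρE r - ρp| ≤ C * (r ^ (2 * (n - 1)))⁻¹ * |um| ^ 2 ∧
            C⁻¹ * (r ^ (n - 1))⁻¹ * |um| ≤ |uE r| ∧
            |uE r| ≤ C * (r ^ (n - 1))⁻¹ * |um|) ∧
      -- (II) the boundary layer solution
      (∀ um ρm : ℝ, 0 < um → 0 < ρm → |um| + |ρm - ρp| ≤ ε₀ →
        ∀ ρE uE : ℝ → ℝ, IsEulerSolution n r₀ p ρp 0 (ρm * um) ρE uE →
        ∃ ρB uB : ℝ → ℝ,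
          IsTheUniquePair 0 (IsBoundaryLayerSolution p (ρE r₀) (uE r₀) ρm um) ρB uB ∧
          ∀ y : ℝ, 0 ≤ y →
            |ρB y - ρE r₀| ≤
              C * Real.exp (-(ν₀ / (ρm * um)) * y) * (|um| ^ 2 + |ρm - ρp|) ∧
            |uB y - uE r₀| ≤
              C * Real.exp (-(ν₀ / (ρm * um)) * y) * (|um| ^ 2 + |ρm - ρp|)) ∧
      -- (III) the inviscid limit of the Navier-Stokes solution
      (∀ α : ℝ, 0 < α → α < 1 → ∃ Cα > (0 : ℝ),
        ∀ um ρm : ℝ, 0 < um → 0 < ρm → |um| + |ρm - ρp| ≤ ε₀ →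
        ∀ ρE uE : ℝ → ℝ, IsEulerSolution n r₀ p ρp 0 (ρm * um) ρE uE →
        ∀ ρB uB : ℝ → ℝ, IsBoundaryLayerSolution p (ρE r₀) (uE r₀) ρm um ρB uB →
        ∀ μ : ℝ, 0 < μ → μ ≤ 1 →
        ∃ ρ u : ℝ → ℝ,
          IsTheUniquePair r₀ (IsNavierStokesSolution n r₀ μ p ρp 0 ρm um) ρ u ∧
          ∀ r : ℝ, r₀ ≤ r →
            |ρ r - ρE r - ρB ((r - r₀) / μ) + ρE r₀| ≤ Cα * μ ^ α ∧
            |u r - uE r - uB ((r - r₀) / μ) + uE r₀| ≤ Cα * μ ^ α) := by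
  have hvb : 0 < ρp⁻¹ := inv_pos.2 hρp
  obtain ⟨δ, ν, K, M, hq⟩ := hp.exists_isPressureWindow hvb
  obtain ⟨h, g, s₀, L, hg⟩ := hp.exists_isBernoulliBranch hρp
  obtain ⟨ε₀, hε₀, hsmall⟩ := exists_small_data hρp hq hg
  obtain ⟨C₁, hC₁, hEuler⟩ := exists_euler_estimate hn hr₀ hp hρp hq hg
  obtain ⟨C₂, hC₂, hLayer⟩ := exists_boundaryLayer_estimate hn hr₀ hp hρp hq hg
  obtain ⟨C₃, hC₃, hNS⟩ := exists_navierStokes_estimate hn hr₀ hp hρp hq hg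
  have hle₁ := le_max_left C₁ C₂
  have hle₂ := le_max_right C₁ C₂
  refine ⟨ε₀, hε₀, ν / 2, half_pos hq.slope_pos, max C₁ C₂, lt_max_of_lt_left hC₁, ?_, ?_, ?_⟩
  · intro um ρm hum hρm hle
    obtain ⟨hε, hlo, hup, -, -⟩ := hsmall um ρm hum hρm hle
    obtain ⟨ρE, uE, hE, hb⟩ := hEuler um ρm hum hρm hε hlo hup
    refine ⟨ρE, uE, hE, fun r hr => ?_⟩
    have hr0 : 0 < r := hr₀.trans_le hr
    obtain ⟨b1, b2, b3⟩ := hb r hr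
    exact ⟨b1.trans (by gcongr), le_trans (by gcongr) b2, b3.trans (by gcongr)⟩
  · intro um ρm hum hρm hle ρE uE hE
    obtain ⟨hε, hlo, hup, hinv, hη⟩ := hsmall um ρm hum hρm hle
    obtain ⟨ρB, uB, hB, hb⟩ := hLayer um ρm hum hρm hε hlo hup hinv hη ρE uE hE
    refine ⟨ρB, uB, hB, fun y hy => ?_⟩
    obtain ⟨b1, b2⟩ := hb y hy
    exact ⟨b1.trans (by gcongr), b2.trans (by gcongr)⟩
  · intro α hα0 hα1
    refine ⟨C₃, hC₃, ?_⟩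
    intro um ρm hum hρm hle ρE uE hE ρB uB hB μ hμ hμ1
    obtain ⟨hε, -, -, -, hη⟩ := hsmall um ρm hum hρm hle
    obtain ⟨ρ, u, hρu, hb⟩ := hNS um ρm hρm hε hη ρE uE hE ρB uB hB μ hμ
    refine ⟨ρ, u, hρu, fun r hr => ?_⟩
    obtain ⟨b1, b2⟩ := hb r hr
    -- The error is in fact `O(μ)`, and `μ ≤ μ ^ α` for `μ ≤ 1`.
    have hμα : μ ≤ μ ^ α := by
      simpa using Real.rpow_le_rpow_of_exponent_ge hμ hμ1 hα1.le
    exact ⟨b1.trans (by gcongr), b2.trans (by gcongr)⟩
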